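/- Let $\mathfrak g$ be a (finite-dimensional) simple real Lie algebra with a Cartan involution $\theta$ and corresponding Cartan decomposition $\mathfrak g=\mathfrak k\oplus\mathfrak p$ such that $\mathfrak z(\mathfrak k)\neq\{0\}$ ($\mathfrak g$ is hermitian), and let $\tau$ be an involutive automorphism of $\mathfrak g$ commuting with $\theta$, with $\mathfrak h=\{X:\tau X=X\}$ and $\mathfrak q=\{X:\tau X=-X\}$. Assume that $(\mathfrak g,\tau)$ is compactly causal, i.e. $\mathfrak z(\mathfrak k)\subseteq\mathfrak q$. Let $Z_0\in i\mathfrak z(\mathfrak k)$ be such that $\operatorname{ad}Z_0$ has spectrum $\{1,0,-1\}$ on $\mathfrak g_{\mathbb C}$, and put $\mathfrak p^+=\{X\in\mathfrak g_{\mathbb C}:[Z_0,X]=X\}$. Let $\mathfrak t\subseteq\mathfrak k$ be a $\tau$-stable Cartan subalgebra of $\mathfrak k$ for which $\mathfrak t\cap\mathfrak q$ is maximal abelian in $\mathfrak k\cap\mathfrak q$, and put $\mathfrak a=i(\mathfrak t\cap\mathfrak q)$. Let $\widehat\Delta$ be the root system of $\mathfrak g_{\mathbb C}$ with respect to $\mathfrak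 t_{\mathbb C}$ and let $\widehat\Delta^+$ be a positive system such that a root $\alpha$ with $\alpha(Z_0)\neq0$ is positive if and only if $\alpha(Z_0)=1$, and such that the non-zero restrictions to $\mathfrak a$ of the elements of $\widehat\Delta^+$ form a positive system in the set of all non-zero restrictions of roots to $\mathfrak a$. Put $\widehat\Delta_k^+=\{\alpha\in\widehat\Delta^+:\alpha(Z_0)=0\}$. For $\lambda\in i\mathfrak t^*$ dominant integral with respect to $\widehat\Delta_k^+$ let $F(\lambda)$ be the irreducible $\mathfrak k_{\mathbb C}$-module of highest weight $\lambda$, let $N(\lambda)=\mathcal U(\mathfrak g_{\mathbb C})\otimes_{\mathcal U(\mathfrak k_{\mathbb C}+\mathfrak p^+)}F(\lambda)$ with $\mathfrak p^+$ acting trivially on $F(\lambda)$, and let $L(\lambda)$ be the quotient of $N(\lambda)$ by its maximal submodule $J(\lambda)$. A $\mathfrak g_{\mathbb C}$-module is called unitary if it has a positive definite hermitian form with $\langle X.v,w\rangle=\langle v,X^*.w\rangle$ for all $X\in\mathfrak g_{\mathbb C}$, where $X^*=-\overline X$ and the bar is conjugation with respect to $\mathfrak g$. It is called spherical if there is a non-zero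 antilinear functional $\nu$ on it with $\nu(X.v)=0$ for all $X\in\mathfrak h$ and all $v$. **Lemma V.13.** Let $\lambda,\mu\in i\mathfrak t^*$ be dominant integral with respect to $\widehat\Delta_k^+$. If $L(\lambda)$ and $L(\mu)$ are unitary and spherical, then $\lambda+\mu$ is dominant integral with respect to $\widehat\Delta_k^+$, and $L(\lambda+\mu)$ is unitary and spherical. Moreover, $L(\lambda)$ and $L(\mu)$ have highest weight vectors (non-zero vectors of weight $\lambda$, respectively $\mu$, annihilated by all positive root vectors), and for all highest weight vectors $v_\lambda\in L(\lambda)$ and $v_\mu\in L(\mu)$ the module $L(\lambda+\mu)$ is isomorphic to the $\mathfrak g_{\mathbb C}$-submodule of $L(\lambda)\otimes L(\mu)$ generated by $v_\lambda\otimes v_\mu$. For all non-zero $\mathfrak h$-invariant antilinear functionals $\nu_\lambda$ on $L(\lambda)$ and $\nu_\mu$ on $L(\mu)$, the restriction of $\nu_\lambda\otimes\nu_\mu$ to this submodule is a non-zero $\mathfrak h$-invariant antilinear functional. -/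

import Mathlib

open scoped TensorProduct

noncomputable section

universe u

/-! ### General algebra -/

/-- The sum of all proper submodules.  For a highest weight module, and for a generalized Verma
module, this is the unique maximal submodule. -/
def sumOfProperSubmodules (R M : Type*) [Ring R] [AddCommGroup M] [Module R M] :
    Submodule R M :=
  sSup {S | S ≠ ⊤}

/-- `P` is a positive system in the set `Φ` of linear functionals on the real vector space `E`:
it consists of those elements of `Φ` that are positive at a point where no element of `Φ`
vanishes. -/
def IsPositiveSystem {E : Type*} [AddCommGroup E] [Module ℝ E]
    (Φ P : Set (Module.Dual ℝ E)) : Prop :=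
  ∃ x : E, (∀ α ∈ Φ, α x ≠ 0) ∧ P = {α ∈ Φ | 0 < α x}

/-- The tensor product of two antilinear functionals,
`(ν₁ ⊗ ν₂) (v ⊗ w) = ν₁ v * ν₂ w`, again an antilinear functional. -/
def antilinearTensor {V W : Type*} [AddCommGroup V] [Module ℂ V] [AddCommGroup W] [Module ℂ W]
    (ν₁ : V →ₛₗ[starRingEnd ℂ] ℂ) (ν₂ : W →ₛₗ[starRingEnd ℂ] ℂ) :
    V ⊗[ℂ] W →ₛₗ[starRingEnd ℂ] ℂ :=
  TensorProduct.lift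
    (LinearMap.mk₂'ₛₗ (starRingEnd ℂ) (starRingEnd ℂ) (fun v w => ν₁ v * ν₂ w)
      (fun v v' w => by simp [add_mul]) (fun c v w => by simp [mul_assoc])
      (fun v w w' => by simp [mul_add]) (fun c v w => by simp [mul_left_comm]))

theorem antilinearTensor_tmul {V W : Type*} [AddCommGroup V] [Module ℂ V] [AddCommGroup W]
    [Module ℂ W] (ν₁ : V →ₛₗ[starRingEnd ℂ] ℂ) (ν₂ : W →ₛₗ[starRingEnd ℂ] ℂ) (v : V) (w : W) :
    antilinearTensor ν₁ ν₂ (v ⊗ₜ[ℂ] w) = ν₁ v * ν₂ w := rfl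

/-! ### The complexification of a real Lie algebra and unitarizable modules -/

section Complexification

variable (𝔤 : Type u) [LieRing 𝔤] [LieAlgebra ℝ 𝔤]

/-- The complexification `𝔤_ℂ = ℂ ⊗ 𝔤`. -/
def Cplx : Type u := ℂ ⊗[ℝ] 𝔤

instance : LieRing (Cplx 𝔤) := inferInstanceAs (LieRing (ℂ ⊗[ℝ] 𝔤))

instance : LieAlgebra ℂ (Cplx 𝔤) := inferInstanceAs (LieAlgebra ℂ (ℂ ⊗[ℝ] 𝔤))

variable {𝔤}

/-- The element `z ⊗ X` of `𝔤_ℂ`. -/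
def Cplx.tmul (z : ℂ) (X : 𝔤) : Cplx 𝔤 := (z ⊗ₜ[ℝ] X : ℂ ⊗[ℝ] 𝔤)

/-- The element `X` of `𝔤`, as an element of `𝔤_ℂ`. -/
def toCplx (X : 𝔤) : Cplx 𝔤 := Cplx.tmul 1 X

/-- The element `i X` of `𝔤_ℂ`, for `X` in `𝔤`. -/
def iMul (X : 𝔤) : Cplx 𝔤 := Cplx.tmul Complex.I X

theorem Cplx.lie_tmul_tmul (z w : ℂ) (X Y : 𝔤) :
    ⁅Cplx.tmul z X, Cplx.tmul w Y⁆ = Cplx.tmul (z * w) ⁅X, Y⁆ := rfl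

theorem Cplx.smul_tmul (c z : ℂ) (X : 𝔤) :
    c • Cplx.tmul z X = Cplx.tmul (c * z) X := rfl

variable (𝔤) in
/-- The conjugation of `𝔤_ℂ` with respect to the real form `𝔤`. -/
def cplxConj : Cplx 𝔤 →ₗ⋆[ℂ] Cplx 𝔤 where
  toFun x := LinearMap.rTensor 𝔤 Complex.conjAe.toLinearMap (x : ℂ ⊗[ℝ] 𝔤)
  map_add' x y := map_add (LinearMap.rTensor 𝔤 Complex.conjAe.toLinearMap) x y
  map_smul' c x := by
    have key : ∀ y : ℂ ⊗[ℝ] 𝔤, LinearMap.rTensor 𝔤 Complex.conjAe.toLinearMap (c • y) =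
        starRingEnd ℂ c • LinearMap.rTensor 𝔤 Complex.conjAe.toLinearMap y := by
      intro y
      induction y using TensorProduct.induction_on with
      | zero => simp
      | tmul z X => simp [TensorProduct.smul_tmul']
      | add a b ha hb => rw [smul_add, map_add, ha, hb, map_add, smul_add]
    exact key x

theorem cplxConj_tmul (z : ℂ) (X : 𝔤) :
    cplxConj 𝔤 (Cplx.tmul z X) = Cplx.tmul (starRingEnd ℂ z) X := rfl

/-- The antilinear involution `X ↦ X^* = - conj X` of `𝔤_ℂ`. -/
def cplxStar (X : Cplx 𝔤) : Cplx 𝔤 := - cplxConj 𝔤 X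

/-- A `𝔤_ℂ`-module is unitarizable if it carries a positive definite contravariant hermitian
form.  The form is antilinear in the first and linear in the second argument. -/
def IsUnitarizable (V : Type*) [AddCommGroup V] [Module ℂ V] [LieRingModule (Cplx 𝔤) V] : Prop :=
  ∃ B : V →ₗ⋆[ℂ] V →ₗ[ℂ] ℂ,
    (∀ v w, B w v = starRingEnd ℂ (B v w)) ∧
    (∀ v, v ≠ 0 → 0 < (B v v).re) ∧
    (∀ (X : Cplx 𝔤) (v w : V), B ⁅X, v⁆ w = B v ⁅cplxStar X, w⁆)

end Complexification

/-! ### Hermitian symmetric Lie algebras -/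

/-- A hermitian symmetric Lie algebra: a real Lie algebra (assumed simple in
the theorem) with a Cartan involution `θ` such that the fixed algebra `𝔨` of `θ` has non-zero
center, and with an involutive automorphism `τ` commuting with `θ`. -/
structure HermitianSymmetric (𝔤 : Type u) [LieRing 𝔤] [LieAlgebra ℝ 𝔤] where
  /-- the Cartan involution -/
  θ : 𝔤 ≃ₗ⁅ℝ⁆ 𝔤
  θ_invol : ∀ X, θ (θ X) = X
  θ_cartan : ∀ X, X ≠ 0 → 0 < - killingForm ℝ 𝔤 X (θ X)
  hermitian : ∃ Z, Z ≠ 0 ∧ θ Z = Z ∧ ∀ X, θ X = X → ⁅Z, X⁆ = 0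
  /-- the involution defining the symmetric structure -/
  τ : 𝔤 ≃ₗ⁅ℝ⁆ 𝔤
  τ_invol : ∀ X, τ (τ X) = X
  τ_θ : ∀ X, τ (θ X) = θ (τ X)

namespace HermitianSymmetric

variable {𝔤 : Type u} [LieRing 𝔤] [LieAlgebra ℝ 𝔤] (S : HermitianSymmetric 𝔤)

/-- `𝔨`, the fixed algebra of the Cartan involution. -/
def k : LieSubalgebra ℝ 𝔤 where
  carrier := {X | S.θ X = X}
  zero_mem' := map_zero _
  add_mem' := fun {a b} (ha : S.θ a = a) (hb : S.θ b = b) => by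
    change S.θ (a + b) = a + b
    rw [map_add, ha, hb]
  smul_mem' := fun c x (hx : S.θ x = x) => by
    change S.θ (c • x) = c • x
    rw [map_smul, hx]
  lie_mem' := fun {a b} (ha : S.θ a = a) (hb : S.θ b = b) => by
    change S.θ ⁅a, b⁆ = ⁅a, b⁆
    rw [LieEquiv.map_lie, ha, hb]

/-- `Z` lies in the center of `𝔨`. -/
def MemCenterK (Z : 𝔤) : Prop := Z ∈ S.k ∧ ∀ X ∈ S.k, ⁅Z, X⁆ = 0

/-- `𝔥`, the fixed space of `τ`. -/
def h : Submodule ℝ 𝔤 := LinearMap.eqLocus (S.τ : 𝔤 →ₗ[ℝ] 𝔤) LinearMap.id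

/-- `𝔮`, the `(-1)`-eigenspace of `τ`. -/
def q : Submodule ℝ 𝔤 := LinearMap.eqLocus (S.τ : 𝔤 →ₗ[ℝ] 𝔤) (-LinearMap.id)

/-- The hermitian symmetric Lie algebra is compactly causal: the center of `𝔨` lies in `𝔮`. -/
def IsCompactlyCausal : Prop := ∀ Z, S.MemCenterK Z → Z ∈ S.q

/-- `𝔨_ℂ`, the complex span of `𝔨` in `𝔤_ℂ`. -/
def kC : LieSubalgebra ℂ (Cplx 𝔤) where
  toSubmodule := Submodule.span ℂ (toCplx '' (S.k : Set 𝔤))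
  lie_mem' := fun {x y} hx hy => by
    change x ∈ Submodule.span ℂ (toCplx '' (S.k : Set 𝔤)) at hx
    change y ∈ Submodule.span ℂ (toCplx '' (S.k : Set 𝔤)) at hy
    change ⁅x, y⁆ ∈ Submodule.span ℂ (toCplx '' (S.k : Set 𝔤))
    induction hx using Submodule.span_induction with
    | mem x hx =>
      obtain ⟨X, hX, rfl⟩ := hx
      induction hy using Submodule.span_induction with
      | mem y hy =>
        obtain ⟨Y, hY, rfl⟩ := hy
        refine Submodule.subset_span ⟨⁅X, Y⁆, S.k.lie_mem hX hY, ?_⟩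
        rw [toCplx, toCplx, toCplx, Cplx.lie_tmul_tmul, one_mul]
      | zero => rw [lie_zero]; exact Submodule.zero_mem _
      | add a b _ _ ha hb => rw [lie_add]; exact Submodule.add_mem _ ha hb
      | smul c a _ ha => rw [lie_smul]; exact Submodule.smul_mem _ c ha
    | zero => rw [zero_lie]; exact Submodule.zero_mem _
    | add a b _ _ ha hb => rw [add_lie]; exact Submodule.add_mem _ ha hb
    | smul c a _ ha => rw [smul_lie]; exact Submodule.smul_mem _ c ha

/-- An antilinear functional on a `𝔤_ℂ`-module that is non-zero and annihilated by `𝔥`. -/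
def IsSphericalFunctional {V : Type*} [AddCommGroup V] [Module ℂ V] [LieRingModule (Cplx 𝔤) V]
    (ν : V →ₛₗ[starRingEnd ℂ] ℂ) : Prop :=
  ν ≠ 0 ∧ ∀ X ∈ S.h, ∀ v : V, ν ⁅toCplx X, v⁆ = 0

/-- A `𝔤_ℂ`-module is spherical if it has a non-zero `𝔥`-invariant antilinear functional. -/
def IsSpherical (V : Type*) [AddCommGroup V] [Module ℂ V] [LieRingModule (Cplx 𝔤) V] : Prop :=
  ∃ ν : V →ₛₗ[starRingEnd ℂ] ℂ, S.IsSphericalFunctional ν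

/-- The weight space in `𝔤_ℂ` of the functional `α` in `i 𝔱^*`.

Here and below an element `α` of `i 𝔱^*` (a complex linear functional on `𝔱_ℂ` that is real on
`i 𝔱`) is recorded by its restriction to the real form `i 𝔱`, transported to `𝔱` by
`X ↦ i X`; so for `X` in `𝔱` the real number `α X` below is the value of the functional
at `i X`. -/
def rootSpace (t : LieSubalgebra ℝ 𝔤)
    (α : Module.Dual ℝ t) : Set (Cplx 𝔤) :=
  {x | ∀ X : t, ⁅iMul (X : 𝔤), x⁆ = (α X : ℂ) • x}

/-- The set of roots of `𝔤_ℂ` with respect to `𝔱_ℂ`. -/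
def roots (t : LieSubalgebra ℝ 𝔤) : Set (Module.Dual ℝ t) :=
  {α | α ≠ 0 ∧ ∃ x ∈ rootSpace t α, x ≠ 0}

/-- The real space `𝔱 ∩ 𝔮`; then `𝔞 = i (𝔱 ∩ 𝔮)`. -/
def tq (t : LieSubalgebra ℝ 𝔤) : Submodule ℝ t := S.q.comap t.toSubmodule.subtype

/-- The set of non-zero restrictions to `𝔞 = i (𝔱 ∩ 𝔮)` of a set of functionals on `i 𝔱`. -/
def restrictedSet (t : LieSubalgebra ℝ 𝔤) (Φ : Set (Module.Dual ℝ t)) :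
    Set (Module.Dual ℝ (S.tq t)) :=
  (fun α : Module.Dual ℝ t => α.comp (S.tq t).subtype) '' Φ \ {0}

/-- The choices on which the parametrization of highest weight modules depends: the normalized
central element `Z₀`, the Cartan subalgebra `𝔱` of `𝔨` and the positive system of roots, adapted
to the symmetric structure. -/
structure CartanData where
  /-- The element of the center of `𝔨` with `Z₀ = i Z`. -/
  Z : 𝔤
  Z_center : S.MemCenterK Z
  Z_spec : spectrum ℂ (LieAlgebra.ad ℂ (Cplx 𝔤) (iMul Z)) = {1, 0, -1}
  /-- The Cartan subalgebra of `𝔨`, i.e. a maximal abelian subalgebra. -/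
  t : LieSubalgebra ℝ 𝔤
  t_le : t ≤ S.k
  t_abelian : ∀ X ∈ t, ∀ Y ∈ t, ⁅X, Y⁆ = 0
  t_maximal : ∀ X ∈ S.k, (∀ Y ∈ t, ⁅X, Y⁆ = 0) → X ∈ t
  /-- `𝔱 = (𝔱 ∩ 𝔥) ⊕ (𝔱 ∩ 𝔮)` -/
  t_stable : ∀ X ∈ t, S.τ X ∈ t
  /-- `𝔱 ∩ 𝔮` is maximal abelian in `𝔮 ∩ 𝔨` -/
  tq_maximal : ∀ X ∈ S.q, X ∈ S.k → (∀ Y ∈ t, Y ∈ S.q → ⁅X, Y⁆ = 0) → X ∈ t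
  /-- The set of positive roots. -/
  pos : Set (Module.Dual ℝ t)
  pos_system : IsPositiveSystem (roots t) pos
  /-- The positive non-compact roots are the roots with value `1` at `Z₀`. -/
  pos_noncompact : ∀ α ∈ roots t,
    α ⟨Z, t_maximal Z Z_center.1 fun Y hY => Z_center.2 Y (t_le hY)⟩ ≠ 0 →
      (α ∈ pos ↔ α ⟨Z, t_maximal Z Z_center.1 fun Y hY => Z_center.2 Y (t_le hY)⟩ = 1)
  /-- The non-zero restrictions of the positive roots to `𝔞` form a positive system of the
  restricted root system. -/
  pos_restricted : IsPositiveSystem (S.restrictedSet t (roots t)) (S.restrictedSet t pos)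

namespace CartanData

variable {S} (C : S.CartanData)

/-- The central element `Z₀`. -/
def Z₀ : Cplx 𝔤 := iMul C.Z

/-- The element `Z` (with `Z₀ = i Z`) as an element of `𝔱`. -/
def Zt : C.t :=
  ⟨C.Z, C.t_maximal C.Z C.Z_center.1 fun Y hY => C.Z_center.2 Y (C.t_le hY)⟩

/-- The space `i 𝔱^*`, with the convention explained above. -/
abbrev Weight : Type u := Module.Dual ℝ C.t

/-- The compact positive roots: those which vanish at `Z₀`. -/
def compactPos : Set C.Weight := {α ∈ C.pos | α C.Zt = 0}

/-- `iMul X` is the coroot of `α`: it lies in `[𝔤^α, 𝔤^{-α}]` and `α` takes the value `2`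
there. -/
def IsCoroot (α : C.Weight) (X : C.t) : Prop :=
  (∃ e ∈ rootSpace C.t α, ∃ f ∈ rootSpace C.t (-α), ⁅e, f⁆ = iMul (X : 𝔤)) ∧ α X = 2

/-- `lam` is dominant integral with respect to the compact positive roots. -/
def IsDominantIntegral (lam : C.Weight) : Prop :=
  ∀ α ∈ C.compactPos, ∀ X : C.t, C.IsCoroot α X → ∃ n : ℕ, lam X = n

/-- `v` is a highest weight vector of weight `lam`: non-zero, of weight `lam`, and
annihilated by all positive root vectors. -/
def IsHighestWeightVector {V : Type*} [AddCommGroup V] [Module ℂ V] [LieRingModule (Cplx 𝔤) V]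
    (lam : C.Weight) (v : V) : Prop :=
  v ≠ 0 ∧ (∀ X : C.t, ⁅iMul (X : 𝔤), v⁆ = (lam X : ℂ) • v) ∧
    ∀ α ∈ C.pos, ∀ x ∈ rootSpace C.t α, ⁅x, v⁆ = 0

/-! #### The module `F(λ)` of `𝔨_ℂ` -/

/-- The left ideal of `U(𝔨_ℂ)` generated by the compact positive root spaces and by the elements
`i X - λ(i X)` for `X` in `𝔱`. -/
def vermaIdeal (lam : C.Weight) :
    Submodule (UniversalEnvelopingAlgebra ℂ S.kC) (UniversalEnvelopingAlgebra ℂ S.kC) :=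
  Submodule.span _
    ({u | ∃ α ∈ C.compactPos, ∃ x : S.kC, (x : Cplx 𝔤) ∈ rootSpace C.t α ∧
        u = UniversalEnvelopingAlgebra.ι ℂ x} ∪
     {u | ∃ (X : C.t) (x : S.kC), (x : Cplx 𝔤) = iMul (X : 𝔤) ∧
        u = UniversalEnvelopingAlgebra.ι ℂ x - algebraMap ℂ _ (lam X : ℂ)})

/-- The Verma module of `𝔨_ℂ` of highest weight `λ`. -/
def VermaK (lam : C.Weight) : Type u :=
  UniversalEnvelopingAlgebra ℂ S.kC ⧸ C.vermaIdeal lam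

instance (lam : C.Weight) : AddCommGroup (C.VermaK lam) :=
  inferInstanceAs (AddCommGroup (UniversalEnvelopingAlgebra ℂ S.kC ⧸ C.vermaIdeal lam))

instance (lam : C.Weight) : Module (UniversalEnvelopingAlgebra ℂ S.kC) (C.VermaK lam) :=
  inferInstanceAs (Module (UniversalEnvelopingAlgebra ℂ S.kC) (UniversalEnvelopingAlgebra ℂ S.kC ⧸ C.vermaIdeal lam))

instance (lam : C.Weight) : Module ℂ (C.VermaK lam) :=
  inferInstanceAs (Module ℂ (UniversalEnvelopingAlgebra ℂ S.kC ⧸ C.vermaIdeal lam))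

instance (lam : C.Weight) : IsScalarTower ℂ (UniversalEnvelopingAlgebra ℂ S.kC) (C.VermaK lam) :=
  inferInstanceAs (IsScalarTower ℂ (UniversalEnvelopingAlgebra ℂ S.kC) (UniversalEnvelopingAlgebra ℂ S.kC ⧸ C.vermaIdeal lam))

/-- The irreducible highest weight module `F(λ)` of `𝔨_ℂ`: the simple quotient of the Verma module.
It is finite-dimensional when `λ` is dominant integral. -/
def F (lam : C.Weight) : Type u :=
  C.VermaK lam ⧸ sumOfProperSubmodules (UniversalEnvelopingAlgebra ℂ S.kC) (C.VermaK lam)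

instance (lam : C.Weight) : AddCommGroup (C.F lam) :=
  inferInstanceAs (AddCommGroup (C.VermaK lam ⧸
    sumOfProperSubmodules (UniversalEnvelopingAlgebra ℂ S.kC) (C.VermaK lam)))

instance (lam : C.Weight) : Module (UniversalEnvelopingAlgebra ℂ S.kC) (C.F lam) :=
  inferInstanceAs (Module (UniversalEnvelopingAlgebra ℂ S.kC) (C.VermaK lam ⧸
    sumOfProperSubmodules (UniversalEnvelopingAlgebra ℂ S.kC) (C.VermaK lam)))

instance (lam : C.Weight) : Module ℂ (C.F lam) :=
  inferInstanceAs (Module ℂ (C.VermaK lam ⧸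
    sumOfProperSubmodules (UniversalEnvelopingAlgebra ℂ S.kC) (C.VermaK lam)))

instance (lam : C.Weight) : IsScalarTower ℂ (UniversalEnvelopingAlgebra ℂ S.kC) (C.F lam) :=
  inferInstanceAs (IsScalarTower ℂ (UniversalEnvelopingAlgebra ℂ S.kC) (C.VermaK lam ⧸
    sumOfProperSubmodules (UniversalEnvelopingAlgebra ℂ S.kC) (C.VermaK lam)))

/-! #### The generalized Verma module `N(λ)` and its simple quotient `L(λ)` -/

/-- The relations defining the tensor product over `U(𝔨_ℂ + 𝔭⁺)`, where
`𝔭⁺ = {x : [Z₀, x] = x}` acts trivially on `F(λ)`. -/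
def inducedRel (lam : C.Weight) :
    Submodule (UniversalEnvelopingAlgebra ℂ (Cplx 𝔤))
      (UniversalEnvelopingAlgebra ℂ (Cplx 𝔤) ⊗[ℂ] C.F lam) :=
  Submodule.span _
    ({m | ∃ (u : UniversalEnvelopingAlgebra ℂ (Cplx 𝔤)) (x : S.kC) (f : C.F lam),
        m = (u * UniversalEnvelopingAlgebra.ι ℂ (x : Cplx 𝔤)) ⊗ₜ[ℂ] f -
          u ⊗ₜ[ℂ] (UniversalEnvelopingAlgebra.ι ℂ x • f)} ∪
     {m | ∃ (u : UniversalEnvelopingAlgebra ℂ (Cplx 𝔤)) (x : Cplx 𝔤) (f : C.F lam),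
        ⁅C.Z₀, x⁆ = x ∧ m = (u * UniversalEnvelopingAlgebra.ι ℂ x) ⊗ₜ[ℂ] f})

/-- The generalized Verma module `N(λ) = U(𝔤_ℂ) ⊗_{U(𝔨_ℂ + 𝔭⁺)} F(λ)`. -/
def N (lam : C.Weight) : Type u :=
  (UniversalEnvelopingAlgebra ℂ (Cplx 𝔤) ⊗[ℂ] C.F lam) ⧸ C.inducedRel lam

instance (lam : C.Weight) : AddCommGroup (C.N lam) :=
  inferInstanceAs (AddCommGroup ((UniversalEnvelopingAlgebra ℂ (Cplx 𝔤) ⊗[ℂ] C.F lam) ⧸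
    C.inducedRel lam))

instance (lam : C.Weight) : Module (UniversalEnvelopingAlgebra ℂ (Cplx 𝔤)) (C.N lam) :=
  inferInstanceAs (Module (UniversalEnvelopingAlgebra ℂ (Cplx 𝔤)) ((UniversalEnvelopingAlgebra ℂ (Cplx 𝔤) ⊗[ℂ] C.F lam) ⧸
    C.inducedRel lam))

instance (lam : C.Weight) : Module ℂ (C.N lam) :=
  inferInstanceAs (Module ℂ ((UniversalEnvelopingAlgebra ℂ (Cplx 𝔤) ⊗[ℂ] C.F lam) ⧸
    C.inducedRel lam))

instance (lam : C.Weight) : IsScalarTower ℂ (UniversalEnvelopingAlgebra ℂ (Cplx 𝔤)) (C.N lam) :=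
  inferInstanceAs (IsScalarTower ℂ (UniversalEnvelopingAlgebra ℂ (Cplx 𝔤)) ((UniversalEnvelopingAlgebra ℂ (Cplx 𝔤) ⊗[ℂ] C.F lam) ⧸
    C.inducedRel lam))

/-- The maximal submodule `J(λ)` of `N(λ)`. -/
abbrev J (lam : C.Weight) : Submodule (UniversalEnvelopingAlgebra ℂ (Cplx 𝔤)) (C.N lam) :=
  sumOfProperSubmodules (UniversalEnvelopingAlgebra ℂ (Cplx 𝔤)) (C.N lam)

/-- The irreducible highest weight module `L(λ) = N(λ) / J(λ)`. -/
def L (lam : C.Weight) : Type u := C.N lam ⧸ C.J lam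

instance (lam : C.Weight) : AddCommGroup (C.L lam) :=
  inferInstanceAs (AddCommGroup (C.N lam ⧸ C.J lam))

instance (lam : C.Weight) : Module (UniversalEnvelopingAlgebra ℂ (Cplx 𝔤)) (C.L lam) :=
  inferInstanceAs (Module (UniversalEnvelopingAlgebra ℂ (Cplx 𝔤)) (C.N lam ⧸ C.J lam))

instance (lam : C.Weight) : Module ℂ (C.L lam) :=
  inferInstanceAs (Module ℂ (C.N lam ⧸ C.J lam))

instance (lam : C.Weight) :
    IsScalarTower ℂ (UniversalEnvelopingAlgebra ℂ (Cplx 𝔤)) (C.L lam) :=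
  inferInstanceAs
    (IsScalarTower ℂ (UniversalEnvelopingAlgebra ℂ (Cplx 𝔤)) (C.N lam ⧸ C.J lam))

attribute [local instance] LieRing.ofAssociativeRing LieAlgebra.ofAssociativeAlgebra in
/-- `𝔤_ℂ` acts on `L(λ)` through `U(𝔤_ℂ)`. -/
instance (lam : C.Weight) : LieRingModule (Cplx 𝔤) (C.L lam) where
  bracket x v := UniversalEnvelopingAlgebra.ι ℂ x • v
  add_lie x y v := by
    rw [map_add, add_smul]
  lie_add x v w := smul_add _ v w
  leibniz_lie x y v := by
    change UniversalEnvelopingAlgebra.ι ℂ x • UniversalEnvelopingAlgebra.ι ℂ y • v =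
      UniversalEnvelopingAlgebra.ι ℂ ⁅x, y⁆ • v +
        UniversalEnvelopingAlgebra.ι ℂ y • UniversalEnvelopingAlgebra.ι ℂ x • v
    rw [LieHom.map_lie, LieRing.of_associative_ring_bracket, sub_smul, mul_smul, mul_smul,
      sub_add_cancel]

instance (lam : C.Weight) : LieModule ℂ (Cplx 𝔤) (C.L lam) where
  smul_lie c x v := by
    change UniversalEnvelopingAlgebra.ι ℂ (c • x) • v =
      c • (UniversalEnvelopingAlgebra.ι ℂ x • v)
    rw [map_smul, smul_assoc]
  lie_smul c x v := by
    change UniversalEnvelopingAlgebra.ι ℂ x • c • v =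
      c • (UniversalEnvelopingAlgebra.ι ℂ x • v)
    rw [← algebraMap_smul (UniversalEnvelopingAlgebra ℂ (Cplx 𝔤)) c v,
      ← algebraMap_smul (UniversalEnvelopingAlgebra ℂ (Cplx 𝔤)) c
        (UniversalEnvelopingAlgebra.ι ℂ x • v), ← mul_smul, ← mul_smul,
      Algebra.commutes]

/-- The submodule of `L(λ) ⊗ L(μ)` generated by `v ⊗ w`. -/
def tensorSubmodule (lam mu : C.Weight) (v : C.L lam) (w : C.L mu) :
    LieSubmodule ℂ (Cplx 𝔤) (C.L lam ⊗[ℂ] C.L mu) :=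
  LieSubmodule.lieSpan ℂ (Cplx 𝔤) {v ⊗ₜ[ℂ] w}

end CartanData

end HermitianSymmetric

end

/-!
Unitarity forces quotients to be irreducible: in a homomorphism `f` from a highest weight module
to a unitarizable module, the image of a proper submodule consists of weight vectors of lower
weight, so it is orthogonal to the image of the highest weight vector and, by contravariance, to
all of `f`; hence it vanishes.  Since the tensor product of two unitarizable modules is
unitarizable, the vector `v_λ ⊗ v_μ` of weight `λ + μ`, which is annihilated by the positive root
vectors, generates a copy of `L(λ + μ)`.

For compactly causal `(𝔤, τ)` there is a decomposition of Iwasawa type: `𝔤_ℂ` is the sum of `𝔥_ℂ`,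
`𝔱_ℂ` and the positive root spaces.  It shows that a highest weight vector generates `L(λ)` under
`𝔥`, so that an `𝔥`-invariant functional is determined by its value there.  In particular
`ν_λ(v_λ) ν_μ(v_μ) ≠ 0`, which makes the restriction of `ν_λ ⊗ ν_μ` non-zero.
-/

noncomputable section

attribute [local instance] LieRing.ofAssociativeRing LieAlgebra.ofAssociativeAlgebra

/-- The `A`-linear extension to `A ⊗ V` of an `R`-linear map from `V` to an `A`-module: the analogue
of `LinearMap.liftBaseChange` over a possibly noncommutative algebra. -/
def liftTensor {R : Type*} (A : Type*) {V M : Type*} [CommSemiring R] [Semiring A] [Algebra R A]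
    [AddCommMonoid V] [Module R V] [AddCommMonoid M] [Module R M] [Module A M]
    [IsScalarTower R A M] (f : V →ₗ[R] M) : A ⊗[R] V →ₗ[A] M :=
  TensorProduct.AlgebraTensorModule.lift (LinearMap.toSpanSingleton A (V →ₗ[R] M) f)

theorem liftTensor_tmul {R A V M : Type*} [CommSemiring R] [Semiring A] [Algebra R A]
    [AddCommMonoid V] [Module R V] [AddCommMonoid M] [Module R M] [Module A M]
    [IsScalarTower R A M] (f : V →ₗ[R] M) (a : A) (v : V) : liftTensor A f (a ⊗ₜ v) = a • f v :=
  rfl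

theorem tmul_ne_zero {K V W : Type*} [Field K] [AddCommGroup V] [Module K V] [AddCommGroup W]
    [Module K W] {v : V} {w : W} (hv : v ≠ 0) (hw : w ≠ 0) : v ⊗ₜ[K] w ≠ 0 := by
  obtain ⟨f, hf⟩ := not_forall.mp (mt (Module.forall_dual_apply_eq_zero_iff K v).mp hv)
  obtain ⟨g, hg⟩ := not_forall.mp (mt (Module.forall_dual_apply_eq_zero_iff K w).mp hw)
  intro h
  have hfg := TensorProduct.dualDistrib_apply (R := K) f g v w
  rw [h, map_zero] at hfg
  exact mul_ne_zero hf hg hfg.symm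

theorem isSimpleModule_quotient_sumOfProperSubmodules (R M : Type*) [Ring R] [AddCommGroup M]
    [Module R M] [Nontrivial (M ⧸ sumOfProperSubmodules R M)] :
    IsSimpleModule R (M ⧸ sumOfProperSubmodules R M) := by
  refine isSimpleModule_iff_isCoatom.mpr ⟨Submodule.Quotient.nontrivial_iff.mp ‹_›, fun Q hQ => ?_⟩
  by_contra hne
  exact hQ.not_ge (le_sSup hne)

section LieModules

variable {R 𝔩 M : Type*} [CommRing R] [LieRing 𝔩] [LieAlgebra R 𝔩]
  [AddCommGroup M] [Module R M] [LieRingModule 𝔩 M] [LieModule R 𝔩 M]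

variable (R 𝔩) in
/-- The stabilizer in `𝔩` of the line spanned by a vector, as a linear subspace of `𝔩`. -/
def lineStabilizer (v : M) : Submodule R 𝔩 :=
  (R ∙ v).comap ((LieModule.toEnd R 𝔩 M).toLinearMap.flip v)

theorem mem_lineStabilizer {v : M} {x : 𝔩} : x ∈ lineStabilizer R 𝔩 v ↔ ⁅x, v⁆ ∈ R ∙ v :=
  Iff.rfl

theorem lie_mem_lieSpan_of_mem_lineStabilizer {v : M} {𝔫 : LieSubalgebra R 𝔩}
    (h : 𝔫.toSubmodule ⊔ lineStabilizer R 𝔩 v = ⊤) {u : M}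
    (hu : u ∈ LieSubmodule.lieSpan R 𝔫 {v}) :
    ∀ z ∈ lineStabilizer R 𝔩 v, ⁅z, u⁆ ∈ LieSubmodule.lieSpan R 𝔫 {v} := by
  induction hu using LieSubmodule.lieSpan_induction with
  | mem u hu =>
    rw [Set.mem_singleton_iff.mp hu]
    exact fun z hz => LieSubmodule.submodule_span_le_lieSpan (mem_lineStabilizer.mp hz)
  | zero => simp
  | add u u' _ _ hu hu' =>
    intro z hz
    rw [lie_add]
    exact add_mem (hu z hz) (hu' z hz)
  | smul c u _ hu =>
    intro z hz
    rw [lie_smul]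
    exact SMulMemClass.smul_mem c (hu z hz)
  | lie y u hyu hu =>
    intro z hz
    obtain ⟨y', hy', z', hz', hsum⟩ :=
      Submodule.mem_sup.mp (h ▸ Submodule.mem_top : ⁅z, (y : 𝔩)⁆ ∈ 𝔫.toSubmodule ⊔ _)
    rw [LieSubalgebra.coe_bracket_of_module, leibniz_lie, ← hsum, add_lie]
    exact add_mem (add_mem (LieSubmodule.lie_mem _ (x := (⟨y', hy'⟩ : 𝔫)) hyu) (hu z' hz'))
      (LieSubmodule.lie_mem _ (x := y) (hu z hz))

theorem lieSpan_singleton_le_of_sup_lineStabilizer_eq_top {v : M} {𝔫 : LieSubalgebra R 𝔩}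
    (h : 𝔫.toSubmodule ⊔ lineStabilizer R 𝔩 v = ⊤) :
    (LieSubmodule.lieSpan R 𝔩 {v}).toSubmodule ≤
      (LieSubmodule.lieSpan R 𝔫 {v}).toSubmodule := by
  let P : LieSubmodule R 𝔩 M :=
    { (LieSubmodule.lieSpan R 𝔫 {v}).toSubmodule with
      lie_mem := fun {x u} hu => by
        obtain ⟨y, hy, z, hz, rfl⟩ :=
          Submodule.mem_sup.mp (h ▸ Submodule.mem_top : x ∈ 𝔫.toSubmodule ⊔ _)
        rw [add_lie]
        exact add_mem (LieSubmodule.lie_mem _ (x := (⟨y, hy⟩ : 𝔫)) hu)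
          (lie_mem_lieSpan_of_mem_lineStabilizer h hu z hz) }
  exact (LieSubmodule.lieSpan_le (N := P)).mpr LieSubmodule.subset_lieSpan

end LieModules

section Eigenspaces

open Module.End

/-- The sum of the eigenspaces of `T` for the real eigenvalues smaller than `r`. -/
def lowerEigenspan {V : Type*} [AddCommGroup V] [Module ℂ V] (T : Module.End ℂ V) (r : ℝ) :
    Submodule ℂ V :=
  ⨆ s : Set.Iio r, eigenspace T ((s : ℝ) : ℂ)

variable {V W : Type*} [AddCommGroup V] [Module ℂ V] [AddCommGroup W] [Module ℂ W]

theorem eigenspace_le_lowerEigenspan (T : Module.End ℂ V) {r s : ℝ} (h : s < r) :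
    eigenspace T (s : ℂ) ≤ lowerEigenspan T r :=
  le_iSup (fun s : Set.Iio r => eigenspace T ((s : ℝ) : ℂ)) ⟨s, h⟩

theorem disjoint_eigenspace_lowerEigenspan (T : Module.End ℂ V) (r : ℝ) :
    Disjoint (eigenspace T (r : ℂ)) (lowerEigenspan T r) :=
  (eigenspaces_iSupIndep T (r : ℂ)).mono_right <| iSup_le fun s =>
    le_iSup₂ (f := fun (c : ℂ) (_ : c ≠ r) => eigenspace T c) ((s : ℝ) : ℂ)
      (Complex.ofReal_injective.ne s.2.ne)

theorem lowerEigenspan_le_comap {T : Module.End ℂ V} {T' : Module.End ℂ W} {f : V →ₗ[ℂ] W}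
    {r r' : ℝ}
    (hf : ∀ s < r, ∀ v ∈ eigenspace T (s : ℂ), f v ∈ lowerEigenspan T' r') :
    lowerEigenspan T r ≤ (lowerEigenspan T' r').comap f :=
  iSup_le fun s => hf s s.2

theorem eigenspace_le_iSup_of_iSup_eq_top {ι K E : Type*} [Field K] [AddCommGroup E]
    [Module K E] (T : Module.End K E) {w : ι → Submodule K E} {c : ι → K}
    (hw : ∀ i, w i ≤ eigenspace T (c i)) (htop : ⨆ i, w i = ⊤) (a : K) :
    eigenspace T a ≤ ⨆ (i) (_ : c i = a), w i := by
  set A := ⨆ (i) (_ : c i = a), w i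
  set B := ⨆ (i) (_ : c i ≠ a), w i
  have hAB : A ⊔ B = ⊤ := by
    rw [← htop, eq_comm]
    exact le_antisymm (iSup_le fun i => by
      by_cases h : c i = a
      · exact le_sup_of_le_left (le_iSup₂_of_le i h le_rfl)
      · exact le_sup_of_le_right (le_iSup₂_of_le i h le_rfl))
      (sup_le (iSup₂_le fun i _ => le_iSup w i) (iSup₂_le fun i _ => le_iSup w i))
  have hA : A ≤ eigenspace T a := iSup₂_le fun i hi => hi ▸ hw i
  have hB : Disjoint B (eigenspace T a) :=
    ((eigenspaces_iSupIndep T) a).symm.mono_left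
      (iSup₂_le fun i hi => le_iSup₂_of_le (c i) hi (hw i))
  calc eigenspace T a = (A ⊔ B) ⊓ eigenspace T a := by rw [hAB, top_inf_eq]
    _ = A ⊔ B ⊓ eigenspace T a := sup_inf_assoc_of_le B hA
    _ = A := by rw [hB.eq_bot, sup_bot_eq]
    _ ≤ A := le_rfl

end Eigenspaces

section TopVectors

open Module.End

variable {𝔩 M V : Type*} [LieRing 𝔩] [LieAlgebra ℂ 𝔩]
  [AddCommGroup M] [Module ℂ M] [LieRingModule 𝔩 M] [LieModule ℂ 𝔩 M]
  [AddCommGroup V] [Module ℂ V] [LieRingModule 𝔩 V] [LieModule ℂ 𝔩 V]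

theorem mem_eigenspace_toEnd {H : 𝔩} {c : ℂ} {u : M} :
    u ∈ eigenspace (LieModule.toEnd ℂ 𝔩 M H) c ↔ ⁅H, u⁆ = c • u :=
  mem_eigenspace_iff

theorem lie_mem_lowerEigenspan_of_mem_eigenspace {H y : 𝔩} {u : M} {r : ℝ}
    (hy : y ∈ lowerEigenspan (LieAlgebra.ad ℂ 𝔩 H) 0)
    (hu : u ∈ eigenspace (LieModule.toEnd ℂ 𝔩 M H) (r : ℂ)) :
    ⁅y, u⁆ ∈ lowerEigenspan (LieModule.toEnd ℂ 𝔩 M H) r := by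
  refine lowerEigenspan_le_comap (f := (LieModule.toEnd ℂ 𝔩 M).toLinearMap.flip u)
    (fun s hs y hy => ?_) hy
  refine eigenspace_le_lowerEigenspan _ (s := s + r) (by linarith)
    (mem_eigenspace_toEnd.mpr ?_)
  have hHy : ⁅H, y⁆ = (s : ℂ) • y := mem_eigenspace_iff.mp hy
  rw [mem_eigenspace_toEnd] at hu
  change ⁅H, ⁅y, u⁆⁆ = ((s + r : ℝ) : ℂ) • ⁅y, u⁆
  rw [leibniz_lie, hHy, hu, smul_lie, lie_smul, ← add_smul, Complex.ofReal_add]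

theorem lie_mem_lowerEigenspan {H y : 𝔩} {u : M} {r : ℝ}
    (hy : y ∈ lowerEigenspan (LieAlgebra.ad ℂ 𝔩 H) 0)
    (hu : u ∈ lowerEigenspan (LieModule.toEnd ℂ 𝔩 M H) r) :
    ⁅y, u⁆ ∈ lowerEigenspan (LieModule.toEnd ℂ 𝔩 M H) r :=
  lowerEigenspan_le_comap (f := LieModule.toEnd ℂ 𝔩 M y)
    (fun _ hs _ hu =>
      iSup_le (fun q => eigenspace_le_lowerEigenspan _ (lt_trans (Set.mem_Iio.mp q.2) hs))
        (lie_mem_lowerEigenspan_of_mem_eigenspace hy hu)) hu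

/-- The Lie subalgebra spanned by the eigenvectors of `ad H` with negative real eigenvalues. -/
def negativePart (H : 𝔩) : LieSubalgebra ℂ 𝔩 where
  toSubmodule := lowerEigenspan (LieAlgebra.ad ℂ 𝔩 H) 0
  lie_mem' := lie_mem_lowerEigenspan

/-- An eigenvector `v` of `H` such that `𝔩` is spanned by the stabilizer of the line through `v`
and the elements which lower the eigenvalue.  A highest weight vector has this property for every
`H` at which all positive roots are positive; it suffices for the elementary theory of highest
weight modules. -/
structure IsTopVector (H : 𝔩) (r : ℝ) (v : M) : Prop where
  lie_eq : ⁅H, v⁆ = (r : ℂ) • v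
  sup_eq_top : (negativePart H).toSubmodule ⊔ lineStabilizer ℂ 𝔩 v = ⊤

theorem map_mem_lowerEigenspan (f : M →ₗ⁅ℂ,𝔩⁆ V) {H : 𝔩} {r : ℝ} {u : M}
    (hu : u ∈ lowerEigenspan (LieModule.toEnd ℂ 𝔩 M H) r) :
    f u ∈ lowerEigenspan (LieModule.toEnd ℂ 𝔩 V H) r :=
  lowerEigenspan_le_comap (f := f.toLinearMap)
    (fun s hs u hu => eigenspace_le_lowerEigenspan _ hs <| mem_eigenspace_toEnd.mpr <| by
      rw [mem_eigenspace_toEnd] at hu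
      rw [LieModuleHom.coe_toLinearMap, ← f.map_lie, hu, map_smul]) hu

namespace IsTopVector

variable {H : 𝔩} {r : ℝ} {v : M}

theorem lieSpan_le (hv : IsTopVector H r v) :
    (LieSubmodule.lieSpan ℂ 𝔩 {v}).toSubmodule ≤
      (ℂ ∙ v) ⊔ lowerEigenspan (LieModule.toEnd ℂ 𝔩 M H) r := by
  let P : LieSubmodule ℂ (negativePart H) M :=
    { (ℂ ∙ v) ⊔ lowerEigenspan (LieModule.toEnd ℂ 𝔩 M H) r with
      lie_mem := fun {y u} hu => by
        obtain ⟨a, ha, w, hw, rfl⟩ := Submodule.mem_sup.mp hu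
        obtain ⟨c, rfl⟩ := Submodule.mem_span_singleton.mp ha
        rw [lie_add, lie_smul]
        refine Submodule.mem_sup_right (add_mem (Submodule.smul_mem _ c ?_)
          (lie_mem_lowerEigenspan y.2 hw))
        exact lie_mem_lowerEigenspan_of_mem_eigenspace y.2 (mem_eigenspace_toEnd.mpr hv.lie_eq) }
  refine (lieSpan_singleton_le_of_sup_lineStabilizer_eq_top hv.sup_eq_top).trans
    ((LieSubmodule.lieSpan_le (N := P)).mpr (Set.singleton_subset_iff.mpr ?_))
  exact Submodule.mem_sup_left (Submodule.mem_span_singleton_self v)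

theorem proper_le_lowerEigenspan (hv : IsTopVector H r v)
    (hspan : LieSubmodule.lieSpan ℂ 𝔩 {v} = ⊤) {Q : LieSubmodule ℂ 𝔩 M} (hQ : Q ≠ ⊤) :
    Q.toSubmodule ≤ lowerEigenspan (LieModule.toEnd ℂ 𝔩 M H) r := by
  intro q hq
  obtain ⟨a, ha, w, hw, rfl⟩ := Submodule.mem_sup.mp
    (hv.lieSpan_le (hspan ▸ LieSubmodule.mem_top q : q ∈ LieSubmodule.lieSpan ℂ 𝔩 {v}))
  obtain ⟨c, rfl⟩ := Submodule.mem_span_singleton.mp ha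
  -- Modulo `Q`, the vector `c • v = -w` is both an `r`-eigenvector and a sum of lower ones.
  let π := LieSubmodule.Quotient.mk' Q
  have hcv : π (c • v) = 0 := by
    refine Submodule.disjoint_def.mp
      (disjoint_eigenspace_lowerEigenspan (LieModule.toEnd ℂ 𝔩 (M ⧸ Q) H) r) _ ?_ ?_
    · rw [mem_eigenspace_toEnd, ← π.map_lie, lie_smul, hv.lie_eq, smul_comm, map_smul]
    · have h : π (c • v) = -π w := by
        rw [eq_neg_iff_add_eq_zero, ← map_add]
        exact (LieSubmodule.Quotient.mk_eq_zero' (N := Q)).mpr hq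
      rw [h]
      exact neg_mem (map_mem_lowerEigenspan π hw)
  have hc : c = 0 := by
    by_contra hc
    refine hQ (top_le_iff.mp (hspan ▸ LieSubmodule.lieSpan_le.mpr ?_))
    have hcvQ : c • v ∈ Q := (LieSubmodule.Quotient.mk_eq_zero' (N := Q)).mp hcv
    have hvQ := SMulMemClass.smul_mem c⁻¹ hcvQ
    rw [inv_smul_smul₀ hc] at hvQ
    exact Set.singleton_subset_iff.mpr hvQ
  rwa [hc, zero_smul, zero_add]

end IsTopVector

end TopVectors

section HermitianForms

open Module.End

/-- The sesquilinear form `B` admits adjoints for the action of `𝔩`, and `H` is self-adjoint. -/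
structure IsContravariant {𝔩 V : Type*} [AddCommGroup V] [Module ℂ V] [LieRing 𝔩]
    [LieRingModule 𝔩 V] (B : V →ₗ⋆[ℂ] V →ₗ[ℂ] ℂ) (H : 𝔩) : Prop where
  exists_adjoint : ∀ x : 𝔩, ∃ y : 𝔩, ∀ v w, B ⁅x, v⁆ w = B v ⁅y, w⁆
  self_adjoint : ∀ v w, B ⁅H, v⁆ w = B v ⁅H, w⁆

variable {𝔩 M V : Type*} [LieRing 𝔩] [LieAlgebra ℂ 𝔩]
  [AddCommGroup M] [Module ℂ M] [LieRingModule 𝔩 M] [LieModule ℂ 𝔩 M]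
  [AddCommGroup V] [Module ℂ V] [LieRingModule 𝔩 V] [LieModule ℂ 𝔩 V]
  {B : V →ₗ⋆[ℂ] V →ₗ[ℂ] ℂ} {H : 𝔩}

theorem IsContravariant.apply_eq_zero_of_mem_lowerEigenspan (hB : IsContravariant B H) {r : ℝ}
    {v w : V} (hv : ⁅H, v⁆ = (r : ℂ) • v)
    (hw : w ∈ lowerEigenspan (LieModule.toEnd ℂ 𝔩 V H) r) : B v w = 0 := by
  suffices lowerEigenspan (LieModule.toEnd ℂ 𝔩 V H) r ≤ LinearMap.ker (B v) from this hw
  refine iSup_le fun s w hw => ?_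
  have h := hB.self_adjoint v w
  rw [hv, mem_eigenspace_toEnd.mp hw, map_smulₛₗ, LinearMap.smul_apply, map_smul,
    Complex.conj_ofReal, smul_eq_mul, smul_eq_mul, ← sub_eq_zero, ← sub_mul,
    mul_eq_zero, sub_eq_zero] at h
  exact h.resolve_left (Complex.ofReal_injective.ne (Set.mem_Iio.mp s.2).ne')

/-- A highest weight module maps to a unitarizable module only through its irreducible quotient:
the image of a proper submodule is orthogonal to the image of the top vector, hence to the image
of the whole module, and so to itself. -/
theorem IsTopVector.proper_le_ker (hB : IsContravariant B H) (hdef : ∀ v, B v v = 0 → v = 0)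
    {r : ℝ} {m : M} (hm : IsTopVector H r m) (hspan : LieSubmodule.lieSpan ℂ 𝔩 {m} = ⊤)
    (f : M →ₗ⁅ℂ,𝔩⁆ V) {Q : LieSubmodule ℂ 𝔩 M} (hQ : Q ≠ ⊤) : Q ≤ f.ker := by
  let P : LieSubmodule ℂ 𝔩 M :=
    { carrier := {u | ∀ q ∈ Q, B (f u) (f q) = 0}
      zero_mem' := fun q _ => by simp
      add_mem' := fun hu hu' q hq => by
        rw [map_add, map_add, LinearMap.add_apply, hu q hq, hu' q hq, add_zero]
      smul_mem' := fun c u hu q hq => by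
        rw [map_smul, map_smulₛₗ, LinearMap.smul_apply, hu q hq, smul_zero]
      lie_mem := fun {x u} hu q hq => by
        obtain ⟨y, hy⟩ := hB.exists_adjoint x
        rw [f.map_lie, hy, ← f.map_lie]
        exact hu _ (Q.lie_mem hq) }
  have hmP : m ∈ P := fun q hq =>
    hB.apply_eq_zero_of_mem_lowerEigenspan (by rw [← f.map_lie, hm.lie_eq, map_smul])
      (map_mem_lowerEigenspan f (hm.proper_le_lowerEigenspan hspan hQ hq))
  have hP : ⊤ ≤ P := hspan ▸ LieSubmodule.lieSpan_le.mpr (Set.singleton_subset_iff.mpr hmP)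
  exact fun q hq => (f.mem_ker).mpr (hdef _ (hP (LieSubmodule.mem_top q) q hq))

end HermitianForms

section EnvelopingAlgebra

open UniversalEnvelopingAlgebra (ι)

variable (R 𝔩 M : Type*) [CommRing R] [LieRing 𝔩] [LieAlgebra R 𝔩] [AddCommGroup M] [Module R M]

/-- The action of `𝔩` on `M` is the restriction of the action of its enveloping algebra. -/
class IsEnvelopingAction [LieRingModule 𝔩 M] [Module (UniversalEnvelopingAlgebra R 𝔩) M] :
    Prop where
  ι_smul : ∀ (x : 𝔩) (m : M), ι R x • m = ⁅x, m⁆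

/-- The action of `𝔩` on a module over its enveloping algebra. -/
abbrev lieRingModuleOfEnveloping [Module (UniversalEnvelopingAlgebra R 𝔩) M] :
    LieRingModule 𝔩 M where
  bracket x m := ι R x • m
  add_lie x y m := by rw [map_add, add_smul]
  lie_add x m n := smul_add _ m n
  leibniz_lie x y m := by
    change ι R x • ι R y • m = ι R ⁅x, y⁆ • m + ι R y • ι R x • m
    rw [LieHom.map_lie, LieRing.of_associative_ring_bracket, sub_smul, mul_smul, mul_smul,
      sub_add_cancel]

/-- The action of the enveloping algebra on a module over the Lie algebra. -/
abbrev envelopingModule [LieRingModule 𝔩 M] [LieModule R 𝔩 M] :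
    Module (UniversalEnvelopingAlgebra R 𝔩) M :=
  Module.compHom M (UniversalEnvelopingAlgebra.lift R (LieModule.toEnd R 𝔩 M)).toRingHom

theorem isEnvelopingAction_envelopingModule [LieRingModule 𝔩 M] [LieModule R 𝔩 M] :
    letI := envelopingModule R 𝔩 M
    IsEnvelopingAction R 𝔩 M :=
  letI := envelopingModule R 𝔩 M
  ⟨fun x m => congrArg (fun T : Module.End R M => T m)
    (UniversalEnvelopingAlgebra.lift_ι_apply R (LieModule.toEnd R 𝔩 M) x)⟩

theorem isScalarTower_envelopingModule [LieRingModule 𝔩 M] [LieModule R 𝔩 M] :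
    letI := envelopingModule R 𝔩 M
    IsScalarTower R (UniversalEnvelopingAlgebra R 𝔩) M :=
  letI := envelopingModule R 𝔩 M
  ⟨fun c u m => congrArg (fun T : Module.End R M => T m)
    (map_smul (UniversalEnvelopingAlgebra.lift R (LieModule.toEnd R 𝔩 M)) c u)⟩

variable {R 𝔩} in
theorem mem_subalgebra_of_ι_mem {A : Subalgebra R (UniversalEnvelopingAlgebra R 𝔩)}
    (hA : ∀ x, ι R x ∈ A) (u : UniversalEnvelopingAlgebra R 𝔩) : u ∈ A := by
  let j : 𝔩 →ₗ⁅R⁆ A :=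
    { (ι R : 𝔩 →ₗ⁅R⁆ UniversalEnvelopingAlgebra R 𝔩).toLinearMap.codRestrict
        (Subalgebra.toSubmodule A) hA with
      map_lie' := fun {x y} => Subtype.ext ((ι R).map_lie x y) }
  have hj : A.val.comp (UniversalEnvelopingAlgebra.lift R j) = AlgHom.id R _ := by
    ext x
    exact congrArg A.val (UniversalEnvelopingAlgebra.lift_ι_apply R j x)
  have hu : A.val (UniversalEnvelopingAlgebra.lift R j u) = u := DFunLike.congr_fun hj u
  rw [← hu]
  exact (UniversalEnvelopingAlgebra.lift R j u).2

variable {R 𝔩 M}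
variable {W : Type*} [AddCommGroup W] [Module R W] [LieRingModule 𝔩 M] [LieRingModule 𝔩 W]
  [Module (UniversalEnvelopingAlgebra R 𝔩) M] [Module (UniversalEnvelopingAlgebra R 𝔩) W]
  [IsScalarTower R (UniversalEnvelopingAlgebra R 𝔩) M]
  [IsScalarTower R (UniversalEnvelopingAlgebra R 𝔩) W]
  [IsEnvelopingAction R 𝔩 M] [IsEnvelopingAction R 𝔩 W]

variable (R 𝔩 M) in
theorem IsEnvelopingAction.lieModule : LieModule R 𝔩 M where
  smul_lie c x m := by
    rw [← ι_smul (R := R), ← ι_smul (R := R), map_smul, smul_assoc]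
  lie_smul c x m := by
    rw [← ι_smul (R := R), ← ι_smul (R := R), smul_algebra_smul_comm]

/-- Subspaces stable under a Lie algebra are the same as submodules for its enveloping algebra. -/
def envelopingSubmodule (P : LieSubmodule R 𝔩 M) :
    Submodule (UniversalEnvelopingAlgebra R 𝔩) M where
  toAddSubmonoid := P.toAddSubmonoid
  smul_mem' u m hm := by
    let A : Subalgebra R (UniversalEnvelopingAlgebra R 𝔩) :=
      { carrier := {u | ∀ m ∈ P, u • m ∈ P}
        mul_mem' := fun ha hb m hm => by
          rw [mul_smul]
          exact ha _ (hb m hm)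
        add_mem' := fun ha hb m hm => by
          rw [add_smul]
          exact add_mem (ha m hm) (hb m hm)
        algebraMap_mem' := fun c m hm => by
          rw [algebraMap_smul]
          exact SMulMemClass.smul_mem c hm }
    refine mem_subalgebra_of_ι_mem (A := A) (fun x m hm => ?_) u m hm
    rw [IsEnvelopingAction.ι_smul]
    exact P.lie_mem hm

/-- The subspace underlying a submodule for the enveloping algebra, as a submodule for the Lie
algebra. -/
def lieSubmoduleOfEnveloping (Q : Submodule (UniversalEnvelopingAlgebra R 𝔩) M) :
    LieSubmodule R 𝔩 M where
  toSubmodule := Q.restrictScalars R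
  lie_mem {x m} hm := by
    rw [← IsEnvelopingAction.ι_smul (R := R)]
    exact Q.smul_mem _ hm

theorem lieSpan_eq_top_of_span_eq_top {m : M}
    (h : Submodule.span (UniversalEnvelopingAlgebra R 𝔩) {m} = ⊤) :
    LieSubmodule.lieSpan R 𝔩 {m} = ⊤ :=
  top_le_iff.mp fun _ _ =>
    (Submodule.span_le (p := envelopingSubmodule (LieSubmodule.lieSpan R 𝔩 {m}))).mpr
      LieSubmodule.subset_lieSpan (h ▸ Submodule.mem_top)

variable (R 𝔩 M) in
theorem isIrreducible_of_isSimpleModule [IsSimpleModule (UniversalEnvelopingAlgebra R 𝔩) M] :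
    LieModule.IsIrreducible R 𝔩 M := by
  have := IsSimpleModule.nontrivial (UniversalEnvelopingAlgebra R 𝔩) M
  refine LieModule.IsIrreducible.mk fun P hP => top_le_iff.mp fun m _ => ?_
  rcases eq_bot_or_eq_top (envelopingSubmodule P) with h | h
  · refine absurd ((LieSubmodule.eq_bot_iff P).mpr fun n hn => ?_) hP
    exact (Submodule.eq_bot_iff _).mp h n hn
  · exact (Submodule.eq_top_iff'.mp h m :)

/-- A linear map over the enveloping algebra, as a homomorphism of Lie modules. -/
def lieModuleHomOfEnveloping (f : M →ₗ[UniversalEnvelopingAlgebra R 𝔩] W) : M →ₗ⁅R,𝔩⁆ W where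
  toLinearMap := f.restrictScalars R
  map_lie' {x m} := by
    change f ⁅x, m⁆ = ⁅x, f m⁆
    rw [← IsEnvelopingAction.ι_smul (R := R), map_smul, IsEnvelopingAction.ι_smul]

theorem lieModuleHomOfEnveloping_apply (f : M →ₗ[UniversalEnvelopingAlgebra R 𝔩] W) (m : M) :
    lieModuleHomOfEnveloping f m = f m :=
  rfl

end EnvelopingAlgebra

section Irreducible

variable {R 𝔩 M W : Type*} [CommRing R] [LieRing 𝔩] [AddCommGroup M] [Module R M]
  [LieRingModule 𝔩 M] [AddCommGroup W] [Module R W] [LieRingModule 𝔩 W]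
  [LieModule.IsIrreducible R 𝔩 M]

theorem lieSpan_singleton_eq_top {m : M} (hm : m ≠ 0) : LieSubmodule.lieSpan R 𝔩 {m} = ⊤ :=
  (eq_bot_or_eq_top _).resolve_left fun h =>
    hm ((LieSubmodule.lieSpan_eq_bot_iff R 𝔩 M).mp h m rfl)

theorem injective_of_apply_ne_zero (f : M →ₗ⁅R,𝔩⁆ W) {m : M} (hm : f m ≠ 0) :
    Function.Injective f :=
  f.ker_eq_bot.mp <| (eq_bot_or_eq_top _).resolve_right fun h =>
    hm (f.mem_ker.mp (h ▸ LieSubmodule.mem_top m))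

end Irreducible

section EnvelopingHighestWeight

variable {𝔩 M V : Type*} [LieRing 𝔩] [LieAlgebra ℂ 𝔩]
  [AddCommGroup M] [Module ℂ M] [LieRingModule 𝔩 M] [LieModule ℂ 𝔩 M]
  [AddCommGroup V] [Module ℂ V] [LieRingModule 𝔩 V] [LieModule ℂ 𝔩 V]
  [Module (UniversalEnvelopingAlgebra ℂ 𝔩) M] [Module (UniversalEnvelopingAlgebra ℂ 𝔩) V]
  [IsScalarTower ℂ (UniversalEnvelopingAlgebra ℂ 𝔩) M]
  [IsScalarTower ℂ (UniversalEnvelopingAlgebra ℂ 𝔩) V]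
  [IsEnvelopingAction ℂ 𝔩 M] [IsEnvelopingAction ℂ 𝔩 V]

theorem sumOfProperSubmodules_le_ker {B : V →ₗ⋆[ℂ] V →ₗ[ℂ] ℂ} {H : 𝔩}
    (hB : IsContravariant B H) (hdef : ∀ v, B v v = 0 → v = 0) {r : ℝ} {m : M}
    (hm : IsTopVector H r m)
    (hspan : Submodule.span (UniversalEnvelopingAlgebra ℂ 𝔩) {m} = ⊤)
    (f : M →ₗ[UniversalEnvelopingAlgebra ℂ 𝔩] V) :
    sumOfProperSubmodules (UniversalEnvelopingAlgebra ℂ 𝔩) M ≤ LinearMap.ker f := by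
  refine sSup_le fun Q hQ => ?_
  refine hm.proper_le_ker hB hdef (lieSpan_eq_top_of_span_eq_top hspan)
    (lieModuleHomOfEnveloping f) (Q := lieSubmoduleOfEnveloping Q) fun h => hQ ?_
  refine top_le_iff.mp fun u _ => ?_
  have hu : u ∈ lieSubmoduleOfEnveloping (R := ℂ) (𝔩 := 𝔩) Q := h ▸ LieSubmodule.mem_top u
  exact hu

end EnvelopingHighestWeight

section PositiveForms

open Module.End

/-- A positive definite hermitian form, antilinear in the first argument. -/
structure IsPosDefForm {V : Type*} [AddCommGroup V] [Module ℂ V] (B : V →ₗ⋆[ℂ] V →ₗ[ℂ] ℂ) :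
    Prop where
  conj_symm : ∀ v w, B w v = starRingEnd ℂ (B v w)
  pos : ∀ v, v ≠ 0 → 0 < (B v v).re

namespace IsPosDefForm

variable {V W : Type*} [AddCommGroup V] [Module ℂ V] [AddCommGroup W] [Module ℂ W]
  {B : V →ₗ⋆[ℂ] V →ₗ[ℂ] ℂ} {B' : W →ₗ⋆[ℂ] W →ₗ[ℂ] ℂ}

theorem eq_zero (hB : IsPosDefForm B) (v : V) (hv : B v v = 0) : v = 0 := by
  by_contra h
  simpa [hv] using hB.pos v h

/-- The inner product given by a positive definite hermitian form. -/
abbrev innerCore (hB : IsPosDefForm B) : InnerProductSpace.Core ℂ V where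
  inner v w := B v w
  conj_inner_symm v w := (hB.conj_symm w v).symm
  re_inner_nonneg v := by
    by_cases hv : v = 0
    · simp [hv]
    · exact (hB.pos v hv).le
  add_left u v w := by simp
  smul_left v w c := by simp
  definite := hB.eq_zero

theorem exists_tensor (hB : IsPosDefForm B) (hB' : IsPosDefForm B') :
    ∃ D : V ⊗[ℂ] W →ₗ⋆[ℂ] V ⊗[ℂ] W →ₗ[ℂ] ℂ,
      IsPosDefForm D ∧ ∀ v w v' w', D (v ⊗ₜ w) (v' ⊗ₜ w') = B v v' * B' w w' := by
  let nV : NormedAddCommGroup V := hB.innerCore.toNormedAddCommGroup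
  let iV : InnerProductSpace ℂ V := InnerProductSpace.ofCore hB.innerCore.toCore
  let nW : NormedAddCommGroup W := hB'.innerCore.toNormedAddCommGroup
  let iW : InnerProductSpace ℂ W := InnerProductSpace.ofCore hB'.innerCore.toCore
  refine ⟨innerₛₗ ℂ, ⟨fun v w => (inner_conj_symm w v).symm, fun v hv => ?_⟩,
    fun _ _ _ _ => rfl⟩
  exact not_le.mp fun h => hv ((re_inner_self_nonpos (𝕜 := ℂ)).mp h)

theorem conj_eigenvalue_eq_self (hB : IsPosDefForm B) {T : Module.End ℂ V}
    (hT : ∀ v w, B (T v) w = B v (T w)) {c : ℂ} {v : V} (hv : v ≠ 0) (h : T v = c • v) :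
    starRingEnd ℂ c = c := by
  have h' := hT v v
  rw [h, map_smulₛₗ, LinearMap.smul_apply, map_smul, smul_eq_mul, smul_eq_mul] at h'
  exact mul_right_cancel₀ (fun h0 => hv (hB.eq_zero v h0)) h'

/-- Simultaneous diagonalization of a commuting real-linear family of symmetric operators. -/
theorem iSup_iInf_eigenspace_eq_top [FiniteDimensional ℂ V] (hB : IsPosDefForm B)
    {T : Type*} [AddCommGroup T] [Module ℝ T] (A : T →ₗ[ℝ] Module.End ℂ V)
    (hcomm : ∀ s t, Commute (A s) (A t)) (hA : ∀ t v w, B (A t v) w = B v (A t w)) :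
    ⨆ α : Module.Dual ℝ T, ⨅ t, eigenspace (A t) (α t : ℂ) = ⊤ := by
  let nV : NormedAddCommGroup V := hB.innerCore.toNormedAddCommGroup
  let iV : InnerProductSpace ℂ V := InnerProductSpace.ofCore hB.innerCore.toCore
  have hsym : ∀ t, (A t).IsSymmetric := hA
  rw [eq_top_iff, ← LinearMap.IsSymmetric.iSup_iInf_eq_top_of_commute hsym
    fun s t _ => hcomm s t]
  refine iSup_le fun χ x hx => ?_
  rcases eq_or_ne x 0 with rfl | hx0
  · exact Submodule.zero_mem _
  have hχ : ∀ t, A t x = χ t • x := fun t => mem_eigenspace_iff.mp ((Submodule.mem_iInf _).mp hx t)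
  have hreal : ∀ t, ((χ t).re : ℂ) = χ t := fun t =>
    Complex.conj_eq_iff_re.mp (hB.conj_eigenvalue_eq_self (hA t) hx0 (hχ t))
  let α : Module.Dual ℝ T :=
    { toFun := fun t => (χ t).re
      map_add' := fun s t => by
        have h : χ (s + t) = χ s + χ t := smul_left_injective ℂ hx0 <| by
          simp only [add_smul, ← hχ, map_add, LinearMap.add_apply]
        rw [h, Complex.add_re]
      map_smul' := fun c t => by
        have h : χ (c • t) = (c : ℂ) * χ t := smul_left_injective ℂ hx0 <| by
          simp only [mul_smul, ← hχ, map_smul, LinearMap.smul_apply, Complex.coe_smul]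
        rw [h, Complex.re_ofReal_mul, smul_eq_mul, RingHom.id_apply] }
  refine Submodule.mem_iSup_of_mem α ((Submodule.mem_iInf _).mpr fun t => ?_)
  rw [mem_eigenspace_iff, hχ]
  exact congrArg (· • x) (hreal t).symm

end IsPosDefForm

end PositiveForms

section Unitarizable

variable {𝔤 V W : Type*} [LieRing 𝔤] [LieAlgebra ℝ 𝔤]
  [AddCommGroup V] [Module ℂ V] [LieRingModule (Cplx 𝔤) V]
  [AddCommGroup W] [Module ℂ W] [LieRingModule (Cplx 𝔤) W]

theorem IsUnitarizable.exists_isPosDefForm (hV : IsUnitarizable (𝔤 := 𝔤) V) :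
    ∃ B : V →ₗ⋆[ℂ] V →ₗ[ℂ] ℂ, IsPosDefForm B ∧
      ∀ (X : Cplx 𝔤) (v w : V), B ⁅X, v⁆ w = B v ⁅cplxStar X, w⁆ :=
  let ⟨B, hsymm, hpos, hB⟩ := hV
  ⟨B, ⟨hsymm, hpos⟩, hB⟩

theorem IsUnitarizable.of_injective (hW : IsUnitarizable (𝔤 := 𝔤) W) (f : V →ₗ⁅ℂ,Cplx 𝔤⁆ W)
    (hf : Function.Injective f) : IsUnitarizable (𝔤 := 𝔤) V := by
  obtain ⟨B, hsymm, hpos, hB⟩ := hW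
  refine ⟨(B.comp f.toLinearMap).compl₂ f.toLinearMap, fun v w => hsymm _ _,
    fun v hv => hpos _ ((map_ne_zero_iff f hf).mpr hv), fun X v w => ?_⟩
  change B (f ⁅X, v⁆) (f w) = B (f v) (f ⁅cplxStar X, w⁆)
  rw [f.map_lie, f.map_lie, hB]

theorem IsUnitarizable.tensorProduct [LieModule ℂ (Cplx 𝔤) V] [LieModule ℂ (Cplx 𝔤) W]
    (hV : IsUnitarizable (𝔤 := 𝔤) V) (hW : IsUnitarizable (𝔤 := 𝔤) W) :
    IsUnitarizable (𝔤 := 𝔤) (V ⊗[ℂ] W) := by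
  obtain ⟨B, hBpos, hB⟩ := hV.exists_isPosDefForm
  obtain ⟨B', hBpos', hB'⟩ := hW.exists_isPosDefForm
  obtain ⟨D, hDpos, hD⟩ := hBpos.exists_tensor hBpos'
  refine ⟨D, hDpos.conj_symm, hDpos.pos, fun X s t => ?_⟩
  induction s using TensorProduct.induction_on with
  | zero => simp
  | add a b ha hb => simp only [lie_add, map_add, LinearMap.add_apply, ha, hb]
  | tmul v w =>
    induction t using TensorProduct.induction_on with
    | zero => simp
    | add a b ha hb => simp only [lie_add, map_add, ha, hb]
    | tmul v' w' =>
      simp only [TensorProduct.LieModule.lie_tmul_right, map_add, LinearMap.add_apply, hD, hB, hB']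

end Unitarizable

section Complexification

variable {𝔤 : Type*} [LieRing 𝔤] [LieAlgebra ℝ 𝔤]

theorem Cplx.induction {p : Cplx 𝔤 → Prop} (zero : p 0) (tmul : ∀ z X, p (Cplx.tmul z X))
    (add : ∀ x y, p x → p y → p (x + y)) (x : Cplx 𝔤) : p x :=
  TensorProduct.induction_on (motive := p) x zero tmul add

instance [FiniteDimensional ℝ 𝔤] : FiniteDimensional ℂ (Cplx 𝔤) :=
  inferInstanceAs (FiniteDimensional ℂ (ℂ ⊗[ℝ] 𝔤))

theorem Cplx.tmul_add (z : ℂ) (X Y : 𝔤) :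
    Cplx.tmul z (X + Y) = Cplx.tmul z X + Cplx.tmul z Y := TensorProduct.tmul_add z X Y

theorem Cplx.tmul_zero (z : ℂ) : Cplx.tmul z (0 : 𝔤) = 0 := TensorProduct.tmul_zero 𝔤 z

theorem Cplx.tmul_smul (z : ℂ) (r : ℝ) (X : 𝔤) :
    Cplx.tmul z (r • X) = (r : ℂ) • Cplx.tmul z X := by
  change z ⊗ₜ[ℝ] (r • X) = ((r : ℂ) * z) ⊗ₜ[ℝ] X
  rw [← TensorProduct.smul_tmul, Complex.real_smul]

theorem Cplx.tmul_eq_smul_toCplx (z : ℂ) (X : 𝔤) : Cplx.tmul z X = z • toCplx X := by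
  rw [toCplx, Cplx.smul_tmul, mul_one]

theorem iMul_eq_smul_toCplx (X : 𝔤) : iMul X = Complex.I • toCplx X :=
  Cplx.tmul_eq_smul_toCplx _ X

theorem toCplx_eq_smul_iMul (X : 𝔤) : toCplx X = (-Complex.I) • iMul X := by
  rw [iMul, toCplx, Cplx.smul_tmul, neg_mul, Complex.I_mul_I, neg_neg]

theorem commute_ad_iMul {X Y : 𝔤} (h : ⁅X, Y⁆ = 0) :
    Commute (LieAlgebra.ad ℂ (Cplx 𝔤) (iMul X)) (LieAlgebra.ad ℂ (Cplx 𝔤) (iMul Y)) := by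
  rw [commute_iff_lie_eq, ← LieHom.map_lie, iMul, iMul, Cplx.lie_tmul_tmul, h, Cplx.tmul_zero,
    map_zero]

/-- The real component `X` of the element `X + i Y` of `𝔤_ℂ`. -/
def cplxRe : Cplx 𝔤 →+ 𝔤 :=
  ((TensorProduct.lid ℝ 𝔤).toLinearMap ∘ₗ LinearMap.rTensor 𝔤 Complex.reLm).toAddMonoidHom

/-- The imaginary component `Y` of the element `X + i Y` of `𝔤_ℂ`. -/
def cplxIm : Cplx 𝔤 →+ 𝔤 :=
  ((TensorProduct.lid ℝ 𝔤).toLinearMap ∘ₗ LinearMap.rTensor 𝔤 Complex.imLm).toAddMonoidHom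

theorem cplxRe_tmul (z : ℂ) (X : 𝔤) : cplxRe (Cplx.tmul z X) = z.re • X := rfl

theorem cplxIm_tmul (z : ℂ) (X : 𝔤) : cplxIm (Cplx.tmul z X) = z.im • X := rfl

theorem cplxRe_toCplx (X : 𝔤) : cplxRe (toCplx X) = X := by simp [toCplx, cplxRe_tmul]

theorem cplxIm_toCplx (X : 𝔤) : cplxIm (toCplx X) = 0 := by simp [toCplx, cplxIm_tmul]

theorem toCplx_cplxRe_add_iMul_cplxIm (x : Cplx 𝔤) :
    toCplx (cplxRe x) + iMul (cplxIm x) = x := by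
  induction x using Cplx.induction with
  | zero => simp [toCplx, iMul, Cplx.tmul_zero]
  | tmul z X =>
    rw [cplxRe_tmul, cplxIm_tmul, iMul, toCplx, Cplx.tmul_smul, Cplx.tmul_smul, ← toCplx, ← iMul,
      iMul_eq_smul_toCplx, smul_smul, ← add_smul, Complex.re_add_im, ← Cplx.tmul_eq_smul_toCplx]
  | add x y hx hy =>
    nth_rewrite 3 [← hx]
    nth_rewrite 3 [← hy]
    simp only [toCplx, iMul, map_add, Cplx.tmul_add]
    abel

theorem cplxRe_smul (c : ℂ) (x : Cplx 𝔤) :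
    cplxRe (c • x) = c.re • cplxRe x - c.im • cplxIm x := by
  induction x using Cplx.induction with
  | zero => simp
  | tmul z X =>
    rw [Cplx.smul_tmul, cplxRe_tmul, cplxRe_tmul, cplxIm_tmul, Complex.mul_re, sub_smul, mul_smul,
      mul_smul]
  | add x y hx hy =>
    rw [smul_add, map_add, hx, hy, map_add, map_add]
    module

theorem cplxIm_smul (c : ℂ) (x : Cplx 𝔤) :
    cplxIm (c • x) = c.re • cplxIm x + c.im • cplxRe x := by
  induction x using Cplx.induction with
  | zero => simp
  | tmul z X =>
    rw [Cplx.smul_tmul, cplxIm_tmul, cplxRe_tmul, cplxIm_tmul, Complex.mul_im, add_smul, mul_smul,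
      mul_smul]
  | add x y hx hy =>
    rw [smul_add, map_add, hx, hy, map_add, map_add]
    module

theorem cplxRe_iMul_lie (T : 𝔤) (x : Cplx 𝔤) : cplxRe ⁅iMul T, x⁆ = -⁅T, cplxIm x⁆ := by
  induction x using Cplx.induction with
  | zero => simp
  | tmul z X => simp [iMul, Cplx.lie_tmul_tmul, cplxRe_tmul, cplxIm_tmul]
  | add x y hx hy => rw [lie_add, map_add, hx, hy, map_add, lie_add, neg_add]

theorem cplxIm_iMul_lie (T : 𝔤) (x : Cplx 𝔤) : cplxIm ⁅iMul T, x⁆ = ⁅T, cplxRe x⁆ := by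
  induction x using Cplx.induction with
  | zero => simp
  | tmul z X => simp [iMul, Cplx.lie_tmul_tmul, cplxRe_tmul, cplxIm_tmul]
  | add x y hx hy => rw [lie_add, map_add, hx, hy, map_add, lie_add]

theorem iMul_lie_eq_zero_iff {T : 𝔤} {x : Cplx 𝔤} :
    ⁅iMul T, x⁆ = 0 ↔ ⁅T, cplxRe x⁆ = 0 ∧ ⁅T, cplxIm x⁆ = 0 := by
  rw [← cplxIm_iMul_lie, ← neg_eq_zero (a := ⁅T, cplxIm x⁆), ← cplxRe_iMul_lie]
  refine ⟨fun h => by rw [h, map_zero, map_zero]; exact ⟨rfl, rfl⟩, fun ⟨him, hre⟩ => ?_⟩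
  rw [← toCplx_cplxRe_add_iMul_cplxIm ⁅iMul T, x⁆, him, hre, toCplx, iMul, Cplx.tmul_zero,
    Cplx.tmul_zero, add_zero]

/-- The complex span in `𝔤_ℂ` of a real subspace of `𝔤`. -/
def cplxSpan (U : Submodule ℝ 𝔤) : Submodule ℂ (Cplx 𝔤) := Submodule.span ℂ (toCplx '' U)

theorem mem_cplxSpan_iff {U : Submodule ℝ 𝔤} {x : Cplx 𝔤} :
    x ∈ cplxSpan U ↔ cplxRe x ∈ U ∧ cplxIm x ∈ U := by
  constructor
  · intro hx
    induction hx using Submodule.span_induction with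
    | mem x hx =>
      obtain ⟨X, hX, rfl⟩ := hx
      rw [cplxRe_toCplx, cplxIm_toCplx]
      exact ⟨hX, U.zero_mem⟩
    | zero => simp
    | add x y _ _ hx hy =>
      rw [map_add, map_add]
      exact ⟨U.add_mem hx.1 hy.1, U.add_mem hx.2 hy.2⟩
    | smul c x _ hx =>
      rw [cplxRe_smul, cplxIm_smul]
      exact ⟨U.sub_mem (U.smul_mem _ hx.1) (U.smul_mem _ hx.2),
        U.add_mem (U.smul_mem _ hx.2) (U.smul_mem _ hx.1)⟩
  · rintro ⟨hre, him⟩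
    rw [← toCplx_cplxRe_add_iMul_cplxIm x, iMul_eq_smul_toCplx]
    exact add_mem (Submodule.subset_span ⟨_, hre, rfl⟩)
      (Submodule.smul_mem _ _ (Submodule.subset_span ⟨_, him, rfl⟩))

theorem iMul_mem_cplxSpan {U : Submodule ℝ 𝔤} {X : 𝔤} (hX : X ∈ U) : iMul X ∈ cplxSpan U := by
  rw [iMul_eq_smul_toCplx]
  exact Submodule.smul_mem _ _ (Submodule.subset_span ⟨X, hX, rfl⟩)

theorem cplxSpan_le_iff {U : Submodule ℝ 𝔤} {P : Submodule ℂ (Cplx 𝔤)} :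
    cplxSpan U ≤ P ↔ ∀ X ∈ U, iMul X ∈ P := by
  refine ⟨fun h X hX => h (iMul_mem_cplxSpan hX), fun h => Submodule.span_le.mpr ?_⟩
  rintro _ ⟨X, hX, rfl⟩
  rw [toCplx_eq_smul_iMul]
  exact P.smul_mem _ (h X hX)

theorem cplxConj_lie (x y : Cplx 𝔤) : cplxConj 𝔤 ⁅x, y⁆ = ⁅cplxConj 𝔤 x, cplxConj 𝔤 y⁆ := by
  induction x using Cplx.induction with
  | zero => simp
  | add a b ha hb => rw [add_lie, map_add, ha, hb, map_add, add_lie]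
  | tmul z X =>
    induction y using Cplx.induction with
    | zero => simp
    | add a b ha hb => rw [lie_add, map_add, ha, hb, map_add, lie_add]
    | tmul w Y => simp only [Cplx.lie_tmul_tmul, cplxConj_tmul, map_mul]

theorem cplxConj_cplxConj (x : Cplx 𝔤) : cplxConj 𝔤 (cplxConj 𝔤 x) = x := by
  induction x using Cplx.induction with
  | zero => simp
  | tmul z X => rw [cplxConj_tmul, cplxConj_tmul, Complex.conj_conj]
  | add x y hx hy => rw [map_add, map_add, hx, hy]

theorem cplxConj_toCplx (X : 𝔤) : cplxConj 𝔤 (toCplx X) = toCplx X := by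
  rw [toCplx, cplxConj_tmul, map_one]

theorem cplxConj_iMul (X : 𝔤) : cplxConj 𝔤 (iMul X) = -iMul X := by
  rw [iMul_eq_smul_toCplx, map_smulₛₗ, Complex.conj_I, cplxConj_toCplx, neg_smul]

theorem cplxStar_iMul (X : 𝔤) : cplxStar (iMul X) = iMul X := by
  rw [cplxStar, cplxConj_iMul, neg_neg]

theorem cplxStar_mem_cplxSpan {U : Submodule ℝ 𝔤} {x : Cplx 𝔤} (hx : x ∈ cplxSpan U) :
    cplxStar x ∈ cplxSpan U := by
  suffices cplxSpan U ≤ (cplxSpan U).comap (cplxConj 𝔤) from neg_mem (this hx)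
  refine cplxSpan_le_iff.mpr fun X hX => ?_
  rw [Submodule.mem_comap, cplxConj_iMul]
  exact neg_mem (iMul_mem_cplxSpan hX)

section Map

variable {𝔤' : Type*} [LieRing 𝔤'] [LieAlgebra ℝ 𝔤']

/-- The complex-linear extension `𝔤_ℂ → 𝔤'_ℂ` of a homomorphism of real Lie algebras. -/
def cplxMap (f : 𝔤 →ₗ⁅ℝ⁆ 𝔤') : Cplx 𝔤 →ₗ⁅ℂ⁆ Cplx 𝔤' :=
  let F : Cplx 𝔤 →ₗ[ℂ] Cplx 𝔤' := LinearMap.baseChange ℂ (f : 𝔤 →ₗ[ℝ] 𝔤')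
  { F with
    map_lie' := fun {x y} => by
      have map_tmul (z : ℂ) (X : 𝔤) : F (Cplx.tmul z X) = Cplx.tmul z (f X) := rfl
      change F ⁅x, y⁆ = ⁅F x, F y⁆
      induction x using Cplx.induction with
      | zero => simp
      | add a b ha hb => rw [add_lie, map_add, ha, hb, map_add, add_lie]
      | tmul z X =>
        induction y using Cplx.induction with
        | zero => simp
        | add a b ha hb => rw [lie_add, map_add, ha, hb, map_add, lie_add]
        | tmul w Y => simp only [Cplx.lie_tmul_tmul, map_tmul, LieHom.map_lie] }

theorem cplxMap_tmul (f : 𝔤 →ₗ⁅ℝ⁆ 𝔤') (z : ℂ) (X : 𝔤) :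
    cplxMap f (Cplx.tmul z X) = Cplx.tmul z (f X) := rfl

theorem cplxRe_cplxMap (f : 𝔤 →ₗ⁅ℝ⁆ 𝔤') (x : Cplx 𝔤) : cplxRe (cplxMap f x) = f (cplxRe x) := by
  induction x using Cplx.induction with
  | zero => simp
  | tmul z X => rw [cplxMap_tmul, cplxRe_tmul, cplxRe_tmul, map_smul]
  | add x y hx hy => rw [map_add, map_add, hx, hy, map_add, map_add]

theorem cplxIm_cplxMap (f : 𝔤 →ₗ⁅ℝ⁆ 𝔤') (x : Cplx 𝔤) : cplxIm (cplxMap f x) = f (cplxIm x) := by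
  induction x using Cplx.induction with
  | zero => simp
  | tmul z X => rw [cplxMap_tmul, cplxIm_tmul, cplxIm_tmul, map_smul]
  | add x y hx hy => rw [map_add, map_add, hx, hy, map_add, map_add]

end Map

/-- The sesquilinear extension to `𝔤_ℂ` of a real bilinear form on `𝔤`, antilinear in the first
argument. -/
def cplxHerm (b : LinearMap.BilinForm ℝ 𝔤) : Cplx 𝔤 →ₗ⋆[ℂ] Cplx 𝔤 →ₗ[ℂ] ℂ :=
  let bC : Cplx 𝔤 →ₗ[ℂ] Cplx 𝔤 →ₗ[ℂ] ℂ := LinearMap.BilinForm.baseChange ℂ b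
  bC.comp (cplxConj 𝔤)

theorem cplxHerm_tmul_tmul (b : LinearMap.BilinForm ℝ 𝔤) (z w : ℂ) (X Y : 𝔤) :
    cplxHerm b (Cplx.tmul z X) (Cplx.tmul w Y) = starRingEnd ℂ z * w * b X Y :=
  Complex.real_smul.trans (mul_comm _ _)

theorem cplxHerm_conj_symm {b : LinearMap.BilinForm ℝ 𝔤} (hb : ∀ X Y, b X Y = b Y X)
    (x y : Cplx 𝔤) : cplxHerm b y x = starRingEnd ℂ (cplxHerm b x y) := by
  induction x using Cplx.induction with
  | zero => simp
  | add x x' hx hx' => rw [map_add, hx, hx', map_add, LinearMap.add_apply, map_add]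
  | tmul z X =>
    induction y using Cplx.induction with
    | zero => simp
    | add y y' hy hy' => rw [map_add, LinearMap.add_apply, hy, hy', map_add, map_add]
    | tmul w Y =>
      rw [cplxHerm_tmul_tmul, cplxHerm_tmul_tmul, map_mul, map_mul, Complex.conj_conj,
        Complex.conj_ofReal, hb Y X]
      ring

theorem isPosDefForm_cplxHerm {b : LinearMap.BilinForm ℝ 𝔤} (hb : ∀ X Y, b X Y = b Y X)
    (hpos : ∀ X, X ≠ 0 → 0 < b X X) : IsPosDefForm (cplxHerm b) where
  conj_symm v w := cplxHerm_conj_symm hb v w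
  pos x hx := by
    have hnonneg (X : 𝔤) : 0 ≤ b X X := by
      rcases eq_or_ne X 0 with rfl | hX
      · simp
      · exact (hpos X hX).le
    have heq : (cplxHerm b x x).re = b (cplxRe x) (cplxRe x) + b (cplxIm x) (cplxIm x) := by
      nth_rewrite 1 2 [← toCplx_cplxRe_add_iMul_cplxIm x]
      simp [toCplx, iMul, cplxHerm_tmul_tmul, hb (cplxIm x)]
    rw [heq]
    by_cases hre : cplxRe x = 0
    · refine add_pos_of_nonneg_of_pos (hnonneg _) (hpos _ fun him => hx ?_)
      rw [← toCplx_cplxRe_add_iMul_cplxIm x, hre, him, toCplx, iMul, Cplx.tmul_zero,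
        Cplx.tmul_zero, add_zero]
    · exact add_pos_of_pos_of_nonneg (hpos _ hre) (hnonneg _)

theorem cplxHerm_iMul_lie {b : LinearMap.BilinForm ℝ 𝔤} {T : 𝔤}
    (hb : ∀ X Y, b ⁅T, X⁆ Y = -b X ⁅T, Y⁆) (x y : Cplx 𝔤) :
    cplxHerm b ⁅iMul T, x⁆ y = cplxHerm b x ⁅iMul T, y⁆ := by
  induction x using Cplx.induction with
  | zero => simp
  | add x x' hx hx' => rw [lie_add, map_add, LinearMap.add_apply, hx, hx', map_add,
      LinearMap.add_apply]
  | tmul z X =>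
    induction y using Cplx.induction with
    | zero => simp
    | add y y' hy hy' => rw [map_add, hy, hy', lie_add, map_add]
    | tmul w Y =>
      rw [iMul, Cplx.lie_tmul_tmul, Cplx.lie_tmul_tmul, cplxHerm_tmul_tmul, cplxHerm_tmul_tmul,
        map_mul, Complex.conj_I, hb, Complex.ofReal_neg]
      ring

end Complexification

theorem exists_lieIdeal_mem_iff_lie_range_ad_eq_zero {R 𝔩 : Type*} [CommRing R] [LieRing 𝔩]
    [LieAlgebra R 𝔩] {Z : 𝔩} (hZ : ∀ w : 𝔩, ∃ u : 𝔩, ⁅Z, w⁆ = ⁅Z, ⁅Z, u⁆⁆) :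
    ∃ I : LieIdeal R 𝔩, ∀ x, x ∈ I ↔ ∀ y : 𝔩, ⁅x, ⁅Z, y⁆⁆ = 0 := by
  refine ⟨{
    carrier := {x | ∀ y : 𝔩, ⁅x, ⁅Z, y⁆⁆ = 0}
    zero_mem' := fun y => zero_lie _
    add_mem' := fun hx hx' y => by rw [add_lie, hx, hx', add_zero]
    smul_mem' := fun c x hx y => by rw [smul_lie, hx, smul_zero]
    lie_mem := ?_ }, fun x => Iff.rfl⟩
  intro w x (hx : ∀ y : 𝔩, ⁅x, ⁅Z, y⁆⁆ = 0) y
  -- `𝔩` is the sum of the centralizer and the range of `ad Z`, and both preserve that range.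
  obtain ⟨u, hu⟩ := hZ w
  have hcent : ⁅x, ⁅w - ⁅Z, u⁆, ⁅Z, y⁆⁆⁆ = 0 := by
    have hcomm : ⁅w - ⁅Z, u⁆, Z⁆ = 0 := by rw [← lie_skew, lie_sub, hu, sub_self, neg_zero]
    rw [leibniz_lie (w - ⁅Z, u⁆), hcomm, zero_lie, zero_add, hx]
  have hrange : ⁅x, ⁅⁅Z, u⁆, ⁅Z, y⁆⁆⁆ = 0 := by
    rw [leibniz_lie, hx, zero_lie, hx, lie_zero, add_zero]
  rw [sub_lie, lie_sub, hrange, sub_zero] at hcent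
  rw [lie_lie, hx, lie_zero, hcent, sub_zero]

namespace HermitianSymmetric

variable {𝔤 : Type*} [LieRing 𝔤] [LieAlgebra ℝ 𝔤]

theorem center_eq_bot (S : HermitianSymmetric 𝔤) : LieAlgebra.center ℝ 𝔤 = ⊥ := by
  refine (LieSubmodule.eq_bot_iff _).mpr fun X hX => ?_
  by_contra h
  have had : LieAlgebra.ad ℝ 𝔤 X = 0 := by
    ext Y
    rw [LieAlgebra.ad_apply, ← lie_skew, (LieModule.mem_maxTrivSubmodule _ _ _ X).mp hX Y,
      neg_zero, LinearMap.zero_apply]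
  have hpos := S.θ_cartan X h
  rw [killingForm_apply_apply, had, LinearMap.zero_comp, map_zero, neg_zero] at hpos
  exact hpos.false

variable (S : HermitianSymmetric 𝔤)

theorem mem_k_iff {X : 𝔤} : X ∈ S.k ↔ S.θ X = X := Iff.rfl

theorem mem_kC_iff {x : Cplx 𝔤} : x ∈ S.kC ↔ cplxRe x ∈ S.k ∧ cplxIm x ∈ S.k :=
  mem_cplxSpan_iff (U := S.k.toSubmodule)

theorem iMul_mem_kC {X : 𝔤} (hX : X ∈ S.k) : iMul X ∈ S.kC :=
  iMul_mem_cplxSpan (U := S.k.toSubmodule) hX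

theorem cplxStar_mem_kC {x : Cplx 𝔤} (hx : x ∈ S.kC) : cplxStar x ∈ S.kC :=
  cplxStar_mem_cplxSpan (U := S.k.toSubmodule) hx

/-- The positive definite inner product `-κ(X, θ Y)` on `𝔤`, where `κ` is the Killing form. -/
def cartanForm : LinearMap.BilinForm ℝ 𝔤 :=
  -(killingForm ℝ 𝔤).compl₂ (S.θ : 𝔤 →ₗ[ℝ] 𝔤)

theorem cartanForm_apply (X Y : 𝔤) : S.cartanForm X Y = -killingForm ℝ 𝔤 X (S.θ Y) := rfl

theorem cartanForm_comm (X Y : 𝔤) : S.cartanForm X Y = S.cartanForm Y X := by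
  rw [cartanForm_apply, cartanForm_apply,
    ← LieAlgebra.killingForm_of_equiv_apply S.θ X (S.θ Y), S.θ_invol, LieModule.traceForm_comm]

theorem cartanForm_lie {T : 𝔤} (hT : T ∈ S.k) (X Y : 𝔤) :
    S.cartanForm ⁅T, X⁆ Y = -S.cartanForm X ⁅T, Y⁆ := by
  rw [cartanForm_apply, cartanForm_apply, LieEquiv.map_lie, S.mem_k_iff.mp hT, ← lie_skew, map_neg,
    LinearMap.neg_apply, killingForm, LieModule.traceForm_apply_lie_apply]

variable {S}

theorem MemCenterK.lie_lie_eq_zero_of_mem_p {Z X Y : 𝔤} (hZ : S.MemCenterK Z)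
    (hX : S.θ X = -X) (hZX : ⁅Z, X⁆ = 0) (hY : S.θ Y = -Y) : ⁅X, ⁅Z, Y⁆⁆ = 0 := by
  have hu : S.θ ⁅X, ⁅Z, Y⁆⁆ = ⁅X, ⁅Z, Y⁆⁆ := by
    rw [LieEquiv.map_lie, LieEquiv.map_lie, hX, hY, S.mem_k_iff.mp hZ.1, lie_neg, lie_neg, neg_lie,
      neg_neg]
  have hcomm : ⁅⁅⁅X, ⁅Z, Y⁆⁆, X⁆, Z⁆ = 0 := by
    rw [← lie_skew, leibniz_lie, hZX, lie_zero, add_zero, hZ.2 _ hu, zero_lie, neg_zero]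
  by_contra hne
  have hpos := S.θ_cartan _ hne
  rw [hu, killingForm, ← LieModule.traceForm_apply_lie_apply,
    ← LieModule.traceForm_apply_lie_apply, hcomm, map_zero, LinearMap.zero_apply, neg_zero] at hpos
  exact hpos.false

theorem MemCenterK.lie_lie_eq_zero {Z X : 𝔤} (hZ : S.MemCenterK Z) (hX : S.θ X = -X)
    (hZX : ⁅Z, X⁆ = 0) (Y : 𝔤) : ⁅X, ⁅Z, Y⁆⁆ = 0 := by
  have hk : ⁅Z, Y + S.θ Y⁆ = 0 :=
    hZ.2 _ (S.mem_k_iff.mpr (by rw [map_add, S.θ_invol, add_comm]))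
  have hp : ⁅X, ⁅Z, Y - S.θ Y⁆⁆ = 0 :=
    hZ.lie_lie_eq_zero_of_mem_p hX hZX (by rw [map_sub, S.θ_invol, neg_sub])
  have hY : (2 : ℝ) • Y = (Y + S.θ Y) + (Y - S.θ Y) := by rw [two_smul]; abel
  refine (smul_eq_zero_iff_right (two_ne_zero (α := ℝ))).mp ?_
  rw [← lie_smul, ← lie_smul, hY, lie_add, hk, zero_add, hp]

theorem MemCenterK.mem_k_of_lie_eq_zero [LieAlgebra.IsSimple ℝ 𝔤] {Z : 𝔤} (hZ : S.MemCenterK Z)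
    (hZ0 : Z ≠ 0) (hsplit : ∀ W : 𝔤, ∃ U : 𝔤, ⁅Z, W⁆ = ⁅Z, ⁅Z, U⁆⁆) {X : 𝔤} (hX : ⁅Z, X⁆ = 0) :
    X ∈ S.k := by
  obtain ⟨I, hI⟩ := exists_lieIdeal_mem_iff_lie_range_ad_eq_zero (R := ℝ) hsplit
  have central_eq_zero {W : 𝔤} (hW : ∀ V : 𝔤, ⁅V, W⁆ = 0) : W = 0 := by
    rw [← LieSubmodule.mem_bot (R := ℝ) (L := 𝔤), ← S.center_eq_bot]
    exact (LieModule.mem_maxTrivSubmodule _ _ _ _).mpr hW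
  have hIbot : I = ⊥ := by
    refine (LieAlgebra.IsSimple.eq_bot_or_eq_top (R := ℝ) I).resolve_right fun htop => hZ0 ?_
    refine central_eq_zero fun Y => central_eq_zero fun W => ?_
    rw [← lie_skew Y Z, lie_neg, (hI W).mp (htop ▸ LieSubmodule.mem_top W), neg_zero]
  have hmem : X - S.θ X ∈ I := by
    refine (hI _).mpr (hZ.lie_lie_eq_zero (by rw [map_sub, S.θ_invol, neg_sub]) ?_)
    rw [lie_sub, hX, ← S.mem_k_iff.mp hZ.1, ← LieEquiv.map_lie, hX, map_zero, sub_zero]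
  rw [hIbot, LieSubmodule.mem_bot, sub_eq_zero] at hmem
  exact hmem.symm

end HermitianSymmetric

section RootSpaces

open Module.End

variable {𝔤 : Type*} [LieRing 𝔤] [LieAlgebra ℝ 𝔤]

namespace HermitianSymmetric

/-- The weight space `rootSpace t α` as a complex subspace of `𝔤_ℂ`. -/
def rootSubmodule (t : LieSubalgebra ℝ 𝔤) (α : Module.Dual ℝ t) : Submodule ℂ (Cplx 𝔤) :=
  ⨅ X : t, eigenspace (LieAlgebra.ad ℂ (Cplx 𝔤) (iMul (X : 𝔤))) (α X : ℂ)

theorem mem_rootSubmodule {t : LieSubalgebra ℝ 𝔤} {α : Module.Dual ℝ t} {x : Cplx 𝔤} :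
    x ∈ rootSubmodule t α ↔ x ∈ rootSpace t α := by
  simp only [rootSubmodule, Submodule.mem_iInf, mem_eigenspace_iff, LieAlgebra.ad_apply]
  rfl

theorem cplxConj_mem_rootSpace {t : LieSubalgebra ℝ 𝔤} {α : Module.Dual ℝ t} {x : Cplx 𝔤}
    (hx : x ∈ rootSpace t α) : cplxConj 𝔤 x ∈ rootSpace t (-α) := fun X => by
  rw [← cplxConj_cplxConj (iMul (X : 𝔤)), ← cplxConj_lie, cplxConj_iMul, neg_lie, hx X, map_neg,
    map_smulₛₗ, Complex.conj_ofReal, LinearMap.neg_apply, Complex.ofReal_neg, neg_smul]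

theorem neg_mem_roots {t : LieSubalgebra ℝ 𝔤} {α : Module.Dual ℝ t} (hα : α ∈ roots t) :
    -α ∈ roots t := by
  obtain ⟨h0, x, hx, hx0⟩ := hα
  refine ⟨neg_ne_zero.mpr h0, cplxConj 𝔤 x, cplxConj_mem_rootSpace hx, fun h => hx0 ?_⟩
  rw [← cplxConj_cplxConj x, h, map_zero]

variable {S : HermitianSymmetric 𝔤}

namespace CartanData

variable (C : S.CartanData)

theorem iSup_rootSubmodule_eq_top [FiniteDimensional ℝ 𝔤] :
    ⨆ α : C.Weight, rootSubmodule C.t α = ⊤ := by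
  let A : C.t →ₗ[ℝ] Module.End ℂ (Cplx 𝔤) :=
    { toFun := fun X => LieAlgebra.ad ℂ (Cplx 𝔤) (iMul (X : 𝔤))
      map_add' := fun X Y => by rw [← map_add, iMul, iMul, iMul, ← Cplx.tmul_add]; rfl
      map_smul' := fun r X => by
        change LieAlgebra.ad ℂ (Cplx 𝔤) (Cplx.tmul _ (r • (X : 𝔤))) = _
        rw [Cplx.tmul_smul, map_smul]
        rfl }
  exact (isPosDefForm_cplxHerm S.cartanForm_comm S.θ_cartan).iSup_iInf_eigenspace_eq_top A
    (fun X Y => commute_ad_iMul (C.t_abelian _ X.2 _ Y.2))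
    fun X => cplxHerm_iMul_lie (S.cartanForm_lie (C.t_le X.2))

theorem rootSubmodule_le_eigenspace (α : C.Weight) :
    rootSubmodule C.t α ≤ eigenspace (LieAlgebra.ad ℂ (Cplx 𝔤) C.Z₀) (α C.Zt : ℂ) :=
  iInf_le _ C.Zt

variable {C} in
theorem apply_Zt_mem {α : C.Weight} {x : Cplx 𝔤} (hx : x ∈ rootSpace C.t α) (hx0 : x ≠ 0) :
    (α C.Zt : ℂ) ∈ ({1, 0, -1} : Set ℂ) := by
  rw [← C.Z_spec]
  exact (Module.End.hasEigenvalue_of_hasEigenvector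
    ⟨C.rootSubmodule_le_eigenspace α (mem_rootSubmodule.mpr hx), hx0⟩).mem_spectrum

theorem Z₀_lie_cube [FiniteDimensional ℝ 𝔤] (x : Cplx 𝔤) :
    ⁅C.Z₀, ⁅C.Z₀, ⁅C.Z₀, x⁆⁆⁆ = ⁅C.Z₀, x⁆ := by
  let T := LieAlgebra.ad ℂ (Cplx 𝔤) C.Z₀
  suffices h : ⨆ α : C.Weight, rootSubmodule C.t α ≤ LinearMap.ker (T ^ 3 - T) by
    rw [C.iSup_rootSubmodule_eq_top] at h
    exact sub_eq_zero.mp (h (Submodule.mem_top (x := x)))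
  refine iSup_le fun α y hy => ?_
  rcases eq_or_ne y 0 with rfl | hy0
  · exact zero_mem _
  have hTy : ∀ c : ℂ, T (c • y) = (c * α C.Zt) • y := fun c => by
    rw [map_smul, mem_eigenspace_iff.mp (C.rootSubmodule_le_eigenspace α hy), smul_smul]
  have hcube : ((T ^ 3 - T) ((1 : ℂ) • y) : Cplx 𝔤) = ((α C.Zt : ℂ) ^ 3 - α C.Zt) • y := by
    rw [LinearMap.sub_apply, pow_three, Module.End.mul_apply, Module.End.mul_apply, hTy, hTy, hTy,
      ← sub_smul]
    ring_nf
  rw [LinearMap.mem_ker, ← one_smul ℂ y, hcube]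
  rcases apply_Zt_mem (mem_rootSubmodule.mp hy) hy0 with h | h | h <;> rw [h] <;> norm_num

theorem Z_lie_cube [FiniteDimensional ℝ 𝔤] (X : 𝔤) :
    ⁅C.Z, ⁅C.Z, ⁅C.Z, X⁆⁆⁆ = -⁅C.Z, X⁆ := by
  have h := congrArg cplxIm (C.Z₀_lie_cube (toCplx X))
  rw [Z₀, cplxIm_iMul_lie, cplxRe_iMul_lie, cplxIm_iMul_lie, cplxRe_toCplx, lie_neg] at h
  exact neg_eq_iff_eq_neg.mp h

theorem Z_ne_zero : C.Z ≠ 0 := by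
  intro h
  have hmem : (1 : ℂ) ∈ spectrum ℂ (LieAlgebra.ad ℂ (Cplx 𝔤) (iMul C.Z)) := by simp [C.Z_spec]
  rw [h, iMul, Cplx.tmul_zero, map_zero] at hmem
  cases subsingleton_or_nontrivial (Module.End ℂ (Cplx 𝔤))
  · rwa [spectrum.of_subsingleton] at hmem
  · simp [spectrum.zero_eq] at hmem

section Simple

variable [FiniteDimensional ℝ 𝔤] [LieAlgebra.IsSimple ℝ 𝔤]

variable {C} in
theorem mem_k_of_Z_lie_eq_zero {X : 𝔤} (hX : ⁅C.Z, X⁆ = 0) : X ∈ S.k :=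
  C.Z_center.mem_k_of_lie_eq_zero C.Z_ne_zero
    (fun W => ⟨-⁅C.Z, W⁆, by rw [lie_neg, lie_neg, C.Z_lie_cube, neg_neg]⟩) hX

theorem mem_kC_iff_Z₀_lie_eq_zero {x : Cplx 𝔤} : x ∈ S.kC ↔ ⁅C.Z₀, x⁆ = 0 := by
  rw [mem_kC_iff, Z₀, iMul_lie_eq_zero_iff]
  exact ⟨fun h => ⟨C.Z_center.2 _ h.1, C.Z_center.2 _ h.2⟩,
    fun h => ⟨mem_k_of_Z_lie_eq_zero h.1, mem_k_of_Z_lie_eq_zero h.2⟩⟩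

theorem rootSubmodule_zero_le : rootSubmodule C.t 0 ≤ cplxSpan C.t.toSubmodule := by
  intro x hx
  have hcomm : ∀ T ∈ C.t, ⁅T, cplxRe x⁆ = 0 ∧ ⁅T, cplxIm x⁆ = 0 := fun T hT =>
    iMul_lie_eq_zero_iff.mp (by
      rw [mem_rootSubmodule.mp hx ⟨T, hT⟩, LinearMap.zero_apply, Complex.ofReal_zero, zero_smul])
  have mem_t {X : 𝔤} (hX : ∀ T ∈ C.t, ⁅T, X⁆ = 0) : X ∈ C.t :=
    C.t_maximal X (mem_k_of_Z_lie_eq_zero (hX C.Z C.Zt.2)) fun T hT => by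
      rw [← lie_skew, hX T hT, neg_zero]
  exact mem_cplxSpan_iff.mpr ⟨mem_t fun T hT => (hcomm T hT).1, mem_t fun T hT => (hcomm T hT).2⟩

end Simple

theorem mem_roots_of_mem_pos {α : C.Weight} (hα : α ∈ C.pos) : α ∈ roots C.t := by
  obtain ⟨_, _, hpos⟩ := C.pos_system
  rw [hpos] at hα
  exact hα.1

theorem exists_regular : ∃ X₀ : C.t, ∀ α ∈ roots C.t, α ∉ C.pos → α X₀ < 0 := by
  obtain ⟨X₀, hne, hpos⟩ := C.pos_system
  refine ⟨X₀, fun α hα hαpos => (hne α hα).lt_of_le (not_lt.mp fun h => hαpos ?_)⟩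
  rw [hpos]
  exact ⟨hα, h⟩

variable {C}

theorem neg_mem_pos {α : C.Weight} (hα : α ∈ roots C.t) (hα' : α ∉ C.pos) : -α ∈ C.pos := by
  obtain ⟨X, hne, hpos⟩ := C.pos_system
  rw [hpos] at hα' ⊢
  refine ⟨neg_mem_roots hα, neg_pos.mpr ?_⟩
  exact (hne α hα).lt_of_le (not_lt.mp fun h => hα' ⟨hα, h⟩)

theorem mem_of_Z₀_lie_eq_self [FiniteDimensional ℝ 𝔤] {P : Submodule ℂ (Cplx 𝔤)}
    (hP : ∀ α ∈ C.pos, rootSubmodule C.t α ≤ P) {x : Cplx 𝔤} (hx : ⁅C.Z₀, x⁆ = x) : x ∈ P := by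
  have hx1 : x ∈ eigenspace (LieAlgebra.ad ℂ (Cplx 𝔤) C.Z₀) 1 :=
    mem_eigenspace_iff.mpr (by rw [LieAlgebra.ad_apply, hx, one_smul])
  refine (iSup₂_le fun α hα y hy => ?_ :
    ⨆ (α : C.Weight) (_ : (α C.Zt : ℂ) = 1), rootSubmodule C.t α ≤ P)
    (eigenspace_le_iSup_of_iSup_eq_top _ C.rootSubmodule_le_eigenspace
      C.iSup_rootSubmodule_eq_top 1 hx1)
  rcases eq_or_ne y 0 with rfl | hy0
  · exact zero_mem _
  have hαZ : α C.Zt = 1 := Complex.ofReal_eq_one.mp hα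
  have hroot : α ∈ roots C.t :=
    ⟨fun h => by simp [h] at hαZ, y, mem_rootSubmodule.mp hy, hy0⟩
  have hαZ0 : α C.Zt ≠ 0 := hαZ ▸ one_ne_zero
  exact hP α ((C.pos_noncompact α hroot hαZ0).mpr hαZ) hy

section Simple

variable [FiniteDimensional ℝ 𝔤] [LieAlgebra.IsSimple ℝ 𝔤]

/-- The triangular decomposition of a Lie algebra `𝔩 ⊆ 𝔤_ℂ` which is a sum of weight spaces. -/
theorem negativePart_sup_eq_top {𝔩 : Type*} [LieRing 𝔩] [LieAlgebra ℂ 𝔩] {j : 𝔩 →ₗ⁅ℂ⁆ Cplx 𝔤}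
    (hj : Function.Injective j)
    (htop : ⨆ α : C.Weight, (rootSubmodule C.t α).comap (j : 𝔩 →ₗ[ℂ] Cplx 𝔤) = ⊤)
    {X₀ : C.t} (hX₀ : ∀ α ∈ roots C.t, α ∉ C.pos → α X₀ < 0) {H : 𝔩} (hH : j H = iMul (X₀ : 𝔤))
    {P : Submodule ℂ 𝔩} (ht : ∀ X ∈ C.t, iMul X ∈ P.map (j : 𝔩 →ₗ[ℂ] Cplx 𝔤))
    (hpos : ∀ α ∈ C.pos, (rootSubmodule C.t α).comap (j : 𝔩 →ₗ[ℂ] Cplx 𝔤) ≤ P) :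
    (negativePart H).toSubmodule ⊔ P = ⊤ := by
  rw [eq_top_iff, ← htop]
  refine iSup_le fun α x hx => ?_
  rcases eq_or_ne x 0 with rfl | hx0
  · exact zero_mem _
  by_cases hα0 : α = 0
  · have hxt : j x ∈ cplxSpan C.t.toSubmodule := C.rootSubmodule_zero_le (hα0 ▸ hx)
    obtain ⟨y, hy, hyx⟩ := Submodule.mem_map.mp (cplxSpan_le_iff.mpr ht hxt)
    exact Submodule.mem_sup_right (hj hyx ▸ hy)
  by_cases hα : α ∈ C.pos
  · exact Submodule.mem_sup_right (hpos α hα hx)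
  have hxα : j x ∈ rootSpace C.t α := mem_rootSubmodule.mp hx
  have hαX₀ : α X₀ < 0 := hX₀ α ⟨hα0, j x, hxα, (map_ne_zero_iff j hj).mpr hx0⟩ hα
  refine Submodule.mem_sup_left (eigenspace_le_lowerEigenspan _ hαX₀ (mem_eigenspace_iff.mpr ?_))
  refine hj ?_
  rw [LieAlgebra.ad_apply, LieHom.map_lie, hH, hxα X₀, map_smul]

variable (C) in
theorem iSup_comap_incl_rootSubmodule_eq_top :
    ⨆ α : C.Weight, (rootSubmodule C.t α).comap (S.kC.incl : S.kC →ₗ[ℂ] Cplx 𝔤) = ⊤ := by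
  refine Submodule.map_injective_of_injective (f := (S.kC.incl : S.kC →ₗ[ℂ] Cplx 𝔤))
    Subtype.val_injective (le_antisymm (Submodule.map_mono le_top) ?_)
  rintro _ ⟨x, -, rfl⟩
  have hx : (x : Cplx 𝔤) ∈ eigenspace (LieAlgebra.ad ℂ (Cplx 𝔤) C.Z₀) 0 :=
    mem_eigenspace_iff.mpr (by
      rw [LieAlgebra.ad_apply, C.mem_kC_iff_Z₀_lie_eq_zero.mp x.2, zero_smul])
  rw [Submodule.map_iSup]
  refine (iSup₂_le fun α hα y hy => ?_ :
    ⨆ (α : C.Weight) (_ : (α C.Zt : ℂ) = 0), rootSubmodule C.t α ≤ _)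
    (eigenspace_le_iSup_of_iSup_eq_top _ C.rootSubmodule_le_eigenspace
      C.iSup_rootSubmodule_eq_top 0 hx)
  have hyk : y ∈ S.kC := C.mem_kC_iff_Z₀_lie_eq_zero.mpr (by
    rw [← LieAlgebra.ad_apply ℂ, mem_eigenspace_iff.mp (C.rootSubmodule_le_eigenspace α hy), hα,
      zero_smul])
  exact Submodule.mem_iSup_of_mem α (Submodule.mem_map.mpr ⟨⟨y, hyk⟩, hy, rfl⟩)

end Simple

end CartanData

end HermitianSymmetric

end RootSpaces

section Involution

variable {𝔤 : Type*} [LieRing 𝔤] [LieAlgebra ℝ 𝔤]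

namespace HermitianSymmetric

section

variable (S : HermitianSymmetric 𝔤)

/-- The complex-linear extension of `τ`. -/
def tauC : Cplx 𝔤 →ₗ⁅ℂ⁆ Cplx 𝔤 := cplxMap (S.τ : 𝔤 →ₗ⁅ℝ⁆ 𝔤)

theorem tauC_tauC (x : Cplx 𝔤) : S.tauC (S.tauC x) = x := by
  induction x using Cplx.induction with
  | zero => simp
  | tmul z X => exact congrArg (Cplx.tmul z) (S.τ_invol X)
  | add x y hx hy => rw [map_add, map_add, hx, hy]

/-- `𝔥_ℂ`, the fixed algebra of the complex-linear extension of `τ`. -/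
def hC : LieSubalgebra ℂ (Cplx 𝔤) where
  toSubmodule := LinearMap.eqLocus (S.tauC : Cplx 𝔤 →ₗ[ℂ] Cplx 𝔤) LinearMap.id
  lie_mem' {x y} (hx : S.tauC x = x) (hy : S.tauC y = y) :=
    show S.tauC ⁅x, y⁆ = ⁅x, y⁆ by rw [LieHom.map_lie, hx, hy]

theorem mem_hC_iff {x : Cplx 𝔤} : x ∈ S.hC ↔ S.tauC x = x := Iff.rfl

theorem add_tauC_mem_hC (x : Cplx 𝔤) : x + S.tauC x ∈ S.hC := by
  rw [mem_hC_iff, map_add, tauC_tauC, add_comm]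

variable {S}

theorem cplxRe_mem_h {x : Cplx 𝔤} (hx : x ∈ S.hC) : cplxRe x ∈ S.h :=
  (cplxRe_cplxMap _ x).symm.trans (congrArg cplxRe hx)

theorem cplxIm_mem_h {x : Cplx 𝔤} (hx : x ∈ S.hC) : cplxIm x ∈ S.h :=
  (cplxIm_cplxMap _ x).symm.trans (congrArg cplxIm hx)

theorem IsSphericalFunctional.apply_hC_lie {V : Type*} [AddCommGroup V] [Module ℂ V]
    [LieRingModule (Cplx 𝔤) V] [LieModule ℂ (Cplx 𝔤) V] {ν : V →ₛₗ[starRingEnd ℂ] ℂ}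
    (hν : S.IsSphericalFunctional ν) {x : Cplx 𝔤} (hx : x ∈ S.hC) (v : V) : ν ⁅x, v⁆ = 0 := by
  rw [← toCplx_cplxRe_add_iMul_cplxIm x, iMul_eq_smul_toCplx, add_lie, smul_lie, map_add,
    hν.2 _ (cplxRe_mem_h hx), map_smulₛₗ, hν.2 _ (cplxIm_mem_h hx), smul_zero, add_zero]

theorem IsSphericalFunctional.apply_ne_zero {V : Type*} [AddCommGroup V] [Module ℂ V]
    [LieRingModule (Cplx 𝔤) V] [LieModule ℂ (Cplx 𝔤) V] {ν : V →ₛₗ[starRingEnd ℂ] ℂ}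
    (hν : S.IsSphericalFunctional ν) {v : V}
    (hv : S.hC.toSubmodule ⊔ lineStabilizer ℂ (Cplx 𝔤) v = ⊤)
    (hspan : LieSubmodule.lieSpan ℂ (Cplx 𝔤) {v} = ⊤) : ν v ≠ 0 := by
  intro h
  let P : LieSubmodule ℂ S.hC V :=
    { LinearMap.ker ν with lie_mem := fun {x u} _ => hν.apply_hC_lie x.2 u }
  have hP : (LieSubmodule.lieSpan ℂ (Cplx 𝔤) {v}).toSubmodule ≤ P.toSubmodule :=
    (lieSpan_singleton_le_of_sup_lineStabilizer_eq_top hv).trans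
      ((LieSubmodule.lieSpan_le (N := P)).mpr (Set.singleton_subset_iff.mpr h))
  rw [hspan] at hP
  exact hν.1 (LinearMap.ext fun u => hP (LieSubmodule.mem_top u))

end

variable {S : HermitianSymmetric 𝔤}

namespace CartanData

variable (C : S.CartanData)

/-- The action of `τ` on `𝔱`. -/
def tauT : C.t →ₗ[ℝ] C.t :=
  (S.τ : 𝔤 →ₗ[ℝ] 𝔤).restrict C.t_stable

variable {C}

theorem tauT_of_mem_tq {X : C.t} (hX : X ∈ S.tq C.t) : C.tauT X = -X := Subtype.ext hX

theorem tauC_mem_rootSpace {α : C.Weight} {x : Cplx 𝔤} (hx : x ∈ rootSpace C.t α) :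
    S.tauC x ∈ rootSpace C.t (α.comp C.tauT) := fun X => by
  have hX : iMul (X : 𝔤) = S.tauC (iMul (C.tauT X : 𝔤)) :=
    congrArg iMul (S.τ_invol (X : 𝔤)).symm
  rw [hX, ← LieHom.map_lie, hx, map_smul, LinearMap.comp_apply]

theorem comp_tauT_comp_subtype (α : C.Weight) :
    (α.comp C.tauT).comp (S.tq C.t).subtype = -α.comp (S.tq C.t).subtype := by
  ext X
  exact (congrArg α (tauT_of_mem_tq X.2)).trans (map_neg α _)

theorem comp_tauT_mem_pos {α : C.Weight} (hα : α ∈ roots C.t) (hα' : α ∉ C.pos)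
    (hres : α.comp (S.tq C.t).subtype ≠ 0) : α.comp C.tauT ∈ C.pos := by
  by_contra hβ
  have hβroot : α.comp C.tauT ∈ roots C.t := by
    obtain ⟨-, x, hx, hx0⟩ := hα
    refine ⟨fun h => hres ?_, S.tauC x, tauC_mem_rootSpace hx, fun h => hx0 ?_⟩
    · rw [← neg_eq_zero, ← comp_tauT_comp_subtype, h, LinearMap.zero_comp]
    · rw [← S.tauC_tauC x, h, map_zero]
  obtain ⟨Y, -, hY⟩ := C.pos_restricted
  have hpos : α.comp (S.tq C.t).subtype ∈ S.restrictedSet C.t C.pos := by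
    refine ⟨⟨-α.comp C.tauT, neg_mem_pos hβroot hβ, ?_⟩, hres⟩
    exact (LinearMap.neg_comp _ _).trans (by rw [comp_tauT_comp_subtype, neg_neg])
  have hneg : -α.comp (S.tq C.t).subtype ∈ S.restrictedSet C.t C.pos :=
    ⟨⟨-α, neg_mem_pos hα hα', LinearMap.neg_comp _ _⟩, neg_ne_zero.mpr hres⟩
  rw [hY] at hpos hneg
  exact lt_asymm hpos.2 (neg_pos.mp hneg.2)

theorem sub_tau_mem_t {X : 𝔤} (hX : X ∈ S.k) (hcomm : ∀ T ∈ C.t, T ∈ S.q → ⁅T, X⁆ = 0) :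
    X - S.τ X ∈ C.t := by
  refine C.tq_maximal _ ?_ (sub_mem hX ?_) fun T hT hTq => ?_
  · change S.τ (X - S.τ X) = -(X - S.τ X)
    rw [map_sub, S.τ_invol, neg_sub]
  · rw [mem_k_iff, ← S.τ_θ, S.mem_k_iff.mp hX]
  · have hτT : S.τ T = -T := hTq
    have hτX : ⁅T, S.τ X⁆ = 0 := by
      rw [← neg_eq_zero, ← neg_lie, ← hτT, ← LieEquiv.map_lie, hcomm T hT hTq, map_zero]
    rw [← lie_skew, lie_sub, hcomm T hT hTq, hτX, sub_zero, neg_zero]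

section Simple

variable [FiniteDimensional ℝ 𝔤] [LieAlgebra.IsSimple ℝ 𝔤]

theorem sub_tauC_mem_cplxSpan_t (hS : S.IsCompactlyCausal) {x : Cplx 𝔤}
    (hx : ∀ T ∈ C.t, T ∈ S.q → ⁅iMul T, x⁆ = 0) : x - S.tauC x ∈ cplxSpan C.t.toSubmodule := by
  have hcomm : ∀ T ∈ C.t, T ∈ S.q → ⁅T, cplxRe x⁆ = 0 ∧ ⁅T, cplxIm x⁆ = 0 :=
    fun T hT hTq => iMul_lie_eq_zero_iff.mp (hx T hT hTq)
  have hZ := hcomm C.Z C.Zt.2 (hS C.Z C.Z_center)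
  rw [mem_cplxSpan_iff, map_sub, map_sub, tauC, cplxRe_cplxMap, cplxIm_cplxMap]
  exact ⟨sub_tau_mem_t (mem_k_of_Z_lie_eq_zero hZ.1) fun T hT hTq => (hcomm T hT hTq).1,
    sub_tau_mem_t (mem_k_of_Z_lie_eq_zero hZ.2) fun T hT hTq => (hcomm T hT hTq).2⟩

/-- The analogue of the Iwasawa decomposition of `𝔤_ℂ` with respect to `𝔥_ℂ`. -/
theorem hC_sup_eq_top (hS : S.IsCompactlyCausal) {P : Submodule ℂ (Cplx 𝔤)}
    (ht : cplxSpan C.t.toSubmodule ≤ P) (hpos : ∀ α ∈ C.pos, rootSubmodule C.t α ≤ P) :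
    S.hC.toSubmodule ⊔ P = ⊤ := by
  rw [eq_top_iff, ← C.iSup_rootSubmodule_eq_top]
  refine iSup_le fun α x hx => ?_
  have hxα := mem_rootSubmodule.mp hx
  rcases eq_or_ne x 0 with rfl | hx0
  · exact zero_mem _
  by_cases hα : α ∈ C.pos
  · exact Submodule.mem_sup_right (hpos α hα hx)
  have hfix : x + S.tauC x ∈ S.hC.toSubmodule ⊔ P :=
    Submodule.mem_sup_left (S.add_tauC_mem_hC x)
  by_cases hres : α.comp (S.tq C.t).subtype = 0
  · have hsub : x - S.tauC x ∈ P := ht <| sub_tauC_mem_cplxSpan_t hS fun T hT hTq => by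
      have hαT : α ⟨T, hT⟩ = 0 := LinearMap.congr_fun hres ⟨⟨T, hT⟩, hTq⟩
      rw [hxα ⟨T, hT⟩, hαT, Complex.ofReal_zero, zero_smul]
    have hx_eq : x = (2⁻¹ : ℂ) • ((x + S.tauC x) + (x - S.tauC x)) := by module
    rw [hx_eq]
    exact Submodule.smul_mem _ _ (add_mem hfix (Submodule.mem_sup_right hsub))
  · have hroot : α ∈ roots C.t := ⟨fun h => hres (by rw [h, LinearMap.zero_comp]), x, hxα, hx0⟩
    rw [← add_sub_cancel_right x (S.tauC x)]
    exact sub_mem hfix (Submodule.mem_sup_right (hpos _ (comp_tauT_mem_pos hroot hα hres)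
      (mem_rootSubmodule.mpr (tauC_mem_rootSpace hxα))))

end Simple

end CartanData

end HermitianSymmetric

end Involution

section HighestWeightModules

open UniversalEnvelopingAlgebra (ι)

variable {𝔤 : Type*} [LieRing 𝔤] [LieAlgebra ℝ 𝔤] {S : HermitianSymmetric 𝔤}

namespace HermitianSymmetric.CartanData

variable {C : S.CartanData} {lam : C.Weight}

section TopVectors

variable [FiniteDimensional ℝ 𝔤] [LieAlgebra.IsSimple ℝ 𝔤]

theorem isTopVector_of_lie_eq {𝔩 M : Type*} [LieRing 𝔩] [LieAlgebra ℂ 𝔩] [AddCommGroup M]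
    [Module ℂ M] [LieRingModule 𝔩 M] [LieModule ℂ 𝔩 M] {j : 𝔩 →ₗ⁅ℂ⁆ Cplx 𝔤}
    (hj : Function.Injective j)
    (htop : ⨆ α : C.Weight, (rootSubmodule C.t α).comap (j : 𝔩 →ₗ[ℂ] Cplx 𝔤) = ⊤)
    {X₀ : C.t} (hX₀ : ∀ α ∈ roots C.t, α ∉ C.pos → α X₀ < 0) {H : 𝔩} (hH : j H = iMul (X₀ : 𝔤))
    {m : M} (ht : ∀ X : C.t, ∃ x, j x = iMul (X : 𝔤) ∧ ⁅x, m⁆ = (lam X : ℂ) • m)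
    (hpos : ∀ α ∈ C.pos, ∀ x, j x ∈ rootSpace C.t α → ⁅x, m⁆ = 0) :
    IsTopVector H (lam X₀) m where
  lie_eq := by
    obtain ⟨x, hx, hxm⟩ := ht X₀
    rwa [hj (hH.trans hx.symm)]
  sup_eq_top := by
    refine negativePart_sup_eq_top hj htop hX₀ hH (fun X hX => ?_) fun α hα x hx => ?_
    · obtain ⟨x, hx, hxm⟩ := ht ⟨X, hX⟩
      refine Submodule.mem_map.mpr ⟨x, mem_lineStabilizer.mpr ?_, hx⟩
      exact Submodule.mem_span_singleton.mpr ⟨_, hxm.symm⟩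
    · rw [mem_lineStabilizer, hpos α hα x (mem_rootSubmodule.mp hx)]
      exact zero_mem _

end TopVectors

section VermaModule

instance (lam : C.Weight) : LieRingModule S.kC (C.VermaK lam) :=
  lieRingModuleOfEnveloping ℂ S.kC (C.VermaK lam)

instance (lam : C.Weight) : IsEnvelopingAction ℂ S.kC (C.VermaK lam) := ⟨fun _ _ => rfl⟩

instance (lam : C.Weight) : LieModule ℂ S.kC (C.VermaK lam) :=
  IsEnvelopingAction.lieModule ℂ S.kC (C.VermaK lam)

variable (C) in
/-- The canonical generator of the Verma module of `𝔨_ℂ`. -/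
def vermaVector (lam : C.Weight) : C.VermaK lam := (C.vermaIdeal lam).mkQ 1

theorem smul_vermaVector (u : UniversalEnvelopingAlgebra ℂ S.kC) :
    u • C.vermaVector lam = (C.vermaIdeal lam).mkQ u :=
  ((C.vermaIdeal lam).mkQ.map_smul u 1).symm.trans (by rw [smul_eq_mul, mul_one])

theorem span_vermaVector :
    Submodule.span (UniversalEnvelopingAlgebra ℂ S.kC) {C.vermaVector lam} = ⊤ :=
  top_le_iff.mp fun v _ => by
    obtain ⟨u, rfl⟩ := (C.vermaIdeal lam).mkQ_surjective v
    exact Submodule.mem_span_singleton.mpr ⟨u, smul_vermaVector u⟩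

theorem lie_vermaVector_of_mem_rootSpace {α : C.Weight} (hα : α ∈ C.compactPos) {x : S.kC}
    (hx : (x : Cplx 𝔤) ∈ rootSpace C.t α) : ⁅x, C.vermaVector lam⁆ = 0 :=
  (smul_vermaVector _).trans <| (Submodule.Quotient.mk_eq_zero _).mpr <|
    Submodule.subset_span (Or.inl ⟨α, hα, x, hx, rfl⟩)

theorem lie_vermaVector_of_coe_eq_iMul {X : C.t} {x : S.kC} (hx : (x : Cplx 𝔤) = iMul (X : 𝔤)) :
    ⁅x, C.vermaVector lam⁆ = (lam X : ℂ) • C.vermaVector lam := by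
  rw [← IsEnvelopingAction.ι_smul (R := ℂ), smul_vermaVector,
    ← algebraMap_smul (UniversalEnvelopingAlgebra ℂ S.kC) (lam X : ℂ), smul_vermaVector]
  exact (Submodule.Quotient.eq _).mpr (Submodule.subset_span (Or.inr ⟨X, x, hx, rfl⟩))

theorem isTopVector_vermaVector [FiniteDimensional ℝ 𝔤] [LieAlgebra.IsSimple ℝ 𝔤] {X₀ : C.t}
    (hX₀ : ∀ α ∈ roots C.t, α ∉ C.pos → α X₀ < 0) :
    IsTopVector (⟨iMul (X₀ : 𝔤), S.iMul_mem_kC (C.t_le X₀.2)⟩ : S.kC) (lam X₀)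
      (C.vermaVector lam) := by
  refine isTopVector_of_lie_eq (j := S.kC.incl) Subtype.val_injective
    C.iSup_comap_incl_rootSubmodule_eq_top hX₀ rfl
    (fun X => ⟨⟨_, S.iMul_mem_kC (C.t_le X.2)⟩, rfl, lie_vermaVector_of_coe_eq_iMul rfl⟩)
    fun α hα x hx => ?_
  by_cases h : α C.Zt = 0
  · exact lie_vermaVector_of_mem_rootSpace ⟨hα, h⟩ hx
  -- The root spaces of the non-compact roots meet `𝔨_ℂ` trivially.
  have hZx : (α C.Zt : ℂ) • (x : Cplx 𝔤) = 0 :=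
    (hx C.Zt).symm.trans (C.mem_kC_iff_Z₀_lie_eq_zero.mp x.2)
  have hx0 : x = 0 :=
    Subtype.ext ((smul_eq_zero.mp hZx).resolve_left (Complex.ofReal_ne_zero.mpr h))
  rw [hx0, zero_lie]

theorem vermaIdeal_le_ker_toSpanSingleton {M : Type*} [AddCommGroup M] [Module ℂ M]
    [LieRingModule S.kC M] [Module (UniversalEnvelopingAlgebra ℂ S.kC) M]
    [IsScalarTower ℂ (UniversalEnvelopingAlgebra ℂ S.kC) M] [IsEnvelopingAction ℂ S.kC M] {m : M}
    (hpos : ∀ α ∈ C.compactPos, ∀ x : S.kC, (x : Cplx 𝔤) ∈ rootSpace C.t α → ⁅x, m⁆ = 0)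
    (ht : ∀ (X : C.t) (x : S.kC), (x : Cplx 𝔤) = iMul (X : 𝔤) → ⁅x, m⁆ = (lam X : ℂ) • m) :
    C.vermaIdeal lam ≤
      LinearMap.ker (LinearMap.toSpanSingleton (UniversalEnvelopingAlgebra ℂ S.kC) M m) := by
  refine Submodule.span_le.mpr ?_
  rintro _ (⟨α, hα, x, hx, rfl⟩ | ⟨X, x, hx, rfl⟩) <;>
    rw [SetLike.mem_coe, LinearMap.mem_ker, LinearMap.toSpanSingleton_apply]
  · rw [IsEnvelopingAction.ι_smul, hpos α hα x hx]
  · rw [sub_smul, IsEnvelopingAction.ι_smul, algebraMap_smul, ht X x hx, sub_self]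

end VermaModule

section F

instance (lam : C.Weight) : LieRingModule S.kC (C.F lam) :=
  lieRingModuleOfEnveloping ℂ S.kC (C.F lam)

instance (lam : C.Weight) : IsEnvelopingAction ℂ S.kC (C.F lam) := ⟨fun _ _ => rfl⟩

instance (lam : C.Weight) : LieModule ℂ S.kC (C.F lam) :=
  IsEnvelopingAction.lieModule ℂ S.kC (C.F lam)

variable (C) in
/-- The projection from the Verma module of `𝔨_ℂ` to its simple quotient `F(λ)`. -/
def vermaToF (lam : C.Weight) : C.VermaK lam →ₗ[UniversalEnvelopingAlgebra ℂ S.kC] C.F lam :=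
  Submodule.mkQ _

variable (C) in
/-- The canonical highest weight vector of `F(λ)`. -/
def FVector (lam : C.Weight) : C.F lam := C.vermaToF lam (C.vermaVector lam)

theorem span_FVector :
    Submodule.span (UniversalEnvelopingAlgebra ℂ S.kC) {C.FVector lam} = ⊤ := by
  have hπ : Function.Surjective (C.vermaToF lam) := Submodule.mkQ_surjective _
  rw [FVector, ← Set.image_singleton, Submodule.span_image, span_vermaVector, Submodule.map_top,
    LinearMap.range_eq_top.mpr hπ]

variable (C) in
theorem isContravariant_iMul (X : C.t) {M : Type*} [AddCommGroup M] [Module ℂ M]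
    [LieRingModule (Cplx 𝔤) M] {B : M →ₗ⋆[ℂ] M →ₗ[ℂ] ℂ}
    (hB : ∀ (x : Cplx 𝔤) (v w : M), B ⁅x, v⁆ w = B v ⁅cplxStar x, w⁆) :
    IsContravariant B (⟨iMul (X : 𝔤), S.iMul_mem_kC (C.t_le X.2)⟩ : S.kC) where
  exists_adjoint x := ⟨⟨_, S.cplxStar_mem_kC x.2⟩, hB x⟩
  self_adjoint v w := by
    simp only [LieSubalgebra.coe_bracket_of_module, hB, cplxStar_iMul]

section UniversalProperty

variable {M : Type*} [AddCommGroup M] [Module (UniversalEnvelopingAlgebra ℂ S.kC) M]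

/-- A homomorphism on the Verma module of `𝔨_ℂ` which kills all proper submodules, as a
homomorphism on `F(λ)`. -/
def FLift (f : C.VermaK lam →ₗ[UniversalEnvelopingAlgebra ℂ S.kC] M)
    (hf : sumOfProperSubmodules _ (C.VermaK lam) ≤ LinearMap.ker f) :
    C.F lam →ₗ[UniversalEnvelopingAlgebra ℂ S.kC] M :=
  Submodule.liftQ _ f hf

theorem FLift_FVector (f : C.VermaK lam →ₗ[UniversalEnvelopingAlgebra ℂ S.kC] M)
    (hf : sumOfProperSubmodules _ (C.VermaK lam) ≤ LinearMap.ker f) :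
    FLift f hf (C.FVector lam) = f (C.vermaVector lam) :=
  rfl

end UniversalProperty

theorem IsHighestWeightVector.exists_F_hom [FiniteDimensional ℝ 𝔤] [LieAlgebra.IsSimple ℝ 𝔤]
    {M : Type*} [AddCommGroup M] [Module ℂ M] [LieRingModule (Cplx 𝔤) M] [LieModule ℂ (Cplx 𝔤) M]
    (hM : IsUnitarizable (𝔤 := 𝔤) M) {m : M} (hm : C.IsHighestWeightVector lam m) :
    ∃ f : C.F lam →ₗ⁅ℂ,S.kC⁆ M, f (C.FVector lam) = m := by
  obtain ⟨B, hB, hBstar⟩ := hM.exists_isPosDefForm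
  obtain ⟨X₀, hX₀⟩ := C.exists_regular
  let := envelopingModule ℂ S.kC M
  have := isEnvelopingAction_envelopingModule ℂ S.kC M
  have := isScalarTower_envelopingModule ℂ S.kC M
  let f : C.VermaK lam →ₗ[UniversalEnvelopingAlgebra ℂ S.kC] M :=
    (C.vermaIdeal lam).liftQ (LinearMap.toSpanSingleton _ M m) <|
      vermaIdeal_le_ker_toSpanSingleton (fun α hα x hx => hm.2.2 α hα.1 x hx) fun X x hx => by
        rw [LieSubalgebra.coe_bracket_of_module, hx, hm.2.1 X]
  have hf : f (C.vermaVector lam) = m := one_smul (UniversalEnvelopingAlgebra ℂ S.kC) m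
  have hker := sumOfProperSubmodules_le_ker (C.isContravariant_iMul X₀ hBstar) hB.eq_zero
    (isTopVector_vermaVector hX₀) span_vermaVector f
  exact ⟨lieModuleHomOfEnveloping (FLift f hker), (FLift_FVector f hker).trans hf⟩

end F

section N

instance (lam : C.Weight) : LieRingModule (Cplx 𝔤) (C.N lam) :=
  lieRingModuleOfEnveloping ℂ (Cplx 𝔤) (C.N lam)

instance (lam : C.Weight) : IsEnvelopingAction ℂ (Cplx 𝔤) (C.N lam) := ⟨fun _ _ => rfl⟩

instance (lam : C.Weight) : LieModule ℂ (Cplx 𝔤) (C.N lam) :=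
  IsEnvelopingAction.lieModule ℂ (Cplx 𝔤) (C.N lam)

variable (C) in
/-- The projection from `U(𝔤_ℂ) ⊗ F(λ)` to the induced module `N(λ)`. -/
def toN (lam : C.Weight) :
    UniversalEnvelopingAlgebra ℂ (Cplx 𝔤) ⊗[ℂ] C.F lam
      →ₗ[UniversalEnvelopingAlgebra ℂ (Cplx 𝔤)] C.N lam :=
  (C.inducedRel lam).mkQ

theorem toN_tmul (u : UniversalEnvelopingAlgebra ℂ (Cplx 𝔤)) (v : C.F lam) :
    C.toN lam (u ⊗ₜ v) = u • C.toN lam (1 ⊗ₜ v) := by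
  rw [← map_smul, TensorProduct.smul_tmul', smul_eq_mul, mul_one]

theorem lie_toN_one_tmul (x : S.kC) (v : C.F lam) :
    ⁅(x : Cplx 𝔤), C.toN lam (1 ⊗ₜ v)⁆ = C.toN lam (1 ⊗ₜ ⁅x, v⁆) := by
  rw [← IsEnvelopingAction.ι_smul (R := ℂ), ← toN_tmul]
  refine (Submodule.Quotient.eq _).mpr (Submodule.subset_span (Or.inl ⟨1, x, v, ?_⟩))
  rw [one_mul]
  rfl

theorem lie_toN_one_tmul_of_Z₀_lie_eq {x : Cplx 𝔤} (hx : ⁅C.Z₀, x⁆ = x) (v : C.F lam) :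
    ⁅x, C.toN lam (1 ⊗ₜ v)⁆ = 0 := by
  rw [← IsEnvelopingAction.ι_smul (R := ℂ), ← toN_tmul]
  refine (Submodule.Quotient.mk_eq_zero _).mpr (Submodule.subset_span (Or.inr ⟨1, x, v, hx, ?_⟩))
  rw [one_mul]

variable (C) in
/-- The canonical homomorphism of `𝔨_ℂ`-modules from `F(λ)` to the induced module `N(λ)`. -/
def FToN (lam : C.Weight) : C.F lam →ₗ⁅ℂ,S.kC⁆ C.N lam where
  toLinearMap := (C.toN lam).restrictScalars ℂ ∘ₗ TensorProduct.mk ℂ _ _ 1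
  map_lie' {x v} := (lie_toN_one_tmul x v).symm

theorem span_range_FToN :
    Submodule.span (UniversalEnvelopingAlgebra ℂ (Cplx 𝔤)) (Set.range (C.FToN lam)) = ⊤ := by
  refine Submodule.eq_top_iff'.mpr fun n => ?_
  obtain ⟨t, rfl⟩ : ∃ t, C.toN lam t = n := (C.inducedRel lam).mkQ_surjective n
  induction t with
  | zero => rw [map_zero]; exact zero_mem _
  | tmul u v =>
    rw [toN_tmul]
    exact Submodule.smul_mem _ u (Submodule.subset_span ⟨v, rfl⟩)
  | add s t hs ht => rw [map_add]; exact add_mem hs ht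

variable (C) in
/-- The canonical highest weight vector of `N(λ)`. -/
def NVector (lam : C.Weight) : C.N lam := C.FToN lam (C.FVector lam)

theorem span_NVector :
    Submodule.span (UniversalEnvelopingAlgebra ℂ (Cplx 𝔤)) {C.NVector lam} = ⊤ := by
  let P : LieSubmodule ℂ S.kC (C.N lam) :=
    { lieSubmoduleOfEnveloping (R := ℂ) (𝔩 := Cplx 𝔤)
        (Submodule.span (UniversalEnvelopingAlgebra ℂ (Cplx 𝔤)) {C.NVector lam}) with
      lie_mem := fun {x _} h => (lieSubmoduleOfEnveloping _).lie_mem (x := (x : Cplx 𝔤)) h }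
  have hP : ⊤ ≤ P.comap (C.FToN lam) := by
    rw [← lieSpan_eq_top_of_span_eq_top span_FVector, LieSubmodule.lieSpan_le,
      Set.singleton_subset_iff]
    exact Submodule.mem_span_singleton_self (C.NVector lam)
  rw [← top_le_iff, ← span_range_FToN, Submodule.span_le]
  rintro _ ⟨v, rfl⟩
  exact hP (LieSubmodule.mem_top v)

theorem lie_FVector_of_coe_eq_iMul {X : C.t} {x : S.kC} (hx : (x : Cplx 𝔤) = iMul (X : 𝔤)) :
    ⁅x, C.FVector lam⁆ = (lam X : ℂ) • C.FVector lam := by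
  rw [FVector, ← lieModuleHomOfEnveloping_apply (R := ℂ) (𝔩 := S.kC),
    ← LieModuleHom.map_lie, lie_vermaVector_of_coe_eq_iMul hx, map_smul]

theorem lie_FVector_of_mem_rootSpace {α : C.Weight} (hα : α ∈ C.compactPos) {x : S.kC}
    (hx : (x : Cplx 𝔤) ∈ rootSpace C.t α) : ⁅x, C.FVector lam⁆ = 0 := by
  rw [FVector, ← lieModuleHomOfEnveloping_apply (R := ℂ) (𝔩 := S.kC),
    ← LieModuleHom.map_lie, lie_vermaVector_of_mem_rootSpace hα hx, map_zero]

theorem lie_iMul_NVector (X : C.t) :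
    ⁅iMul (X : 𝔤), C.NVector lam⁆ = (lam X : ℂ) • C.NVector lam := by
  have h := (C.FToN lam).map_lie ⟨_, S.iMul_mem_kC (C.t_le X.2)⟩ (C.FVector lam)
  rw [lie_FVector_of_coe_eq_iMul rfl, map_smul] at h
  exact h.symm

theorem lie_NVector_of_mem_rootSpace [FiniteDimensional ℝ 𝔤] [LieAlgebra.IsSimple ℝ 𝔤]
    {α : C.Weight} (hα : α ∈ C.pos) {x : Cplx 𝔤} (hx : x ∈ rootSpace C.t α) :
    ⁅x, C.NVector lam⁆ = 0 := by
  have hZx : ⁅C.Z₀, x⁆ = (α C.Zt : ℂ) • x := hx C.Zt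
  by_cases h0 : α C.Zt = 0
  · have hxk : x ∈ S.kC := C.mem_kC_iff_Z₀_lie_eq_zero.mpr (by
      rw [hZx, h0, Complex.ofReal_zero, zero_smul])
    have h := (C.FToN lam).map_lie ⟨x, hxk⟩ (C.FVector lam)
    rw [lie_FVector_of_mem_rootSpace (x := ⟨x, hxk⟩) ⟨hα, h0⟩ hx, map_zero] at h
    exact h.symm
  · have h1 : α C.Zt = 1 := (C.pos_noncompact α (C.mem_roots_of_mem_pos hα) h0).mp hα
    rw [h1, Complex.ofReal_one, one_smul] at hZx
    exact lie_toN_one_tmul_of_Z₀_lie_eq hZx _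

section UniversalProperty

variable {M : Type*} [AddCommGroup M] [Module ℂ M] [LieRingModule (Cplx 𝔤) M]

theorem lie_eq_zero_of_Z₀_lie_eq [FiniteDimensional ℝ 𝔤] [LieAlgebra.IsSimple ℝ 𝔤]
    [LieModule ℂ (Cplx 𝔤) M] {f : C.F lam →ₗ⁅ℂ,S.kC⁆ M}
    (hf : C.IsHighestWeightVector lam (f (C.FVector lam))) {x : Cplx 𝔤} (hx : ⁅C.Z₀, x⁆ = x)
    (v : C.F lam) : ⁅x, f v⁆ = 0 := by
  -- The invariants of `𝔭⁺` form a `𝔨_ℂ`-submodule, because `𝔨_ℂ` normalizes `𝔭⁺`.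
  let P : LieSubmodule ℂ S.kC M :=
    { carrier := {m | ∀ x : Cplx 𝔤, ⁅C.Z₀, x⁆ = x → ⁅x, m⁆ = 0}
      zero_mem' := fun x _ => lie_zero x
      add_mem' := fun ha hb x hx => by rw [lie_add, ha x hx, hb x hx, add_zero]
      smul_mem' := fun c a ha x hx => by rw [lie_smul, ha x hx, smul_zero]
      lie_mem := fun {y m} hm x hx => by
        have hxy : ⁅C.Z₀, ⁅x, (y : Cplx 𝔤)⁆⁆ = ⁅x, (y : Cplx 𝔤)⁆ := by
          rw [leibniz_lie, hx, C.mem_kC_iff_Z₀_lie_eq_zero.mp y.2, lie_zero, add_zero]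
        rw [LieSubalgebra.coe_bracket_of_module, leibniz_lie, hm _ hxy, hm x hx, lie_zero,
          add_zero] }
  have hFP : C.FVector lam ∈ P.comap f := fun x hx =>
    mem_of_Z₀_lie_eq_self
      (P := LinearMap.ker ((LieModule.toEnd ℂ (Cplx 𝔤) M).toLinearMap.flip (f (C.FVector lam))))
      (fun α hα y hy => hf.2.2 α hα y (mem_rootSubmodule.mp hy)) hx
  have hP : ⊤ ≤ P.comap f := by
    rw [← lieSpan_eq_top_of_span_eq_top span_FVector, LieSubmodule.lieSpan_le,
      Set.singleton_subset_iff]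
    exact hFP
  exact hP (LieSubmodule.mem_top v) x hx

variable [Module (UniversalEnvelopingAlgebra ℂ (Cplx 𝔤)) M]
  [IsScalarTower ℂ (UniversalEnvelopingAlgebra ℂ (Cplx 𝔤)) M] [IsEnvelopingAction ℂ (Cplx 𝔤) M]

theorem inducedRel_le_ker_liftTensor {f : C.F lam →ₗ⁅ℂ,S.kC⁆ M}
    (hf : ∀ x : Cplx 𝔤, ⁅C.Z₀, x⁆ = x → ∀ v, ⁅x, f v⁆ = 0) :
    C.inducedRel lam ≤ LinearMap.ker
      (liftTensor (UniversalEnvelopingAlgebra ℂ (Cplx 𝔤)) (f : C.F lam →ₗ[ℂ] M)) := by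
  refine Submodule.span_le.mpr ?_
  rintro _ (⟨u, x, v, rfl⟩ | ⟨u, x, v, hx, rfl⟩) <;> rw [SetLike.mem_coe, LinearMap.mem_ker]
  · rw [map_sub, liftTensor_tmul, liftTensor_tmul, mul_smul,
      IsEnvelopingAction.ι_smul, IsEnvelopingAction.ι_smul, ← smul_sub]
    rw [LieModuleHom.coe_toLinearMap, f.map_lie, LieSubalgebra.coe_bracket_of_module, sub_self,
      smul_zero]
  · rw [liftTensor_tmul, mul_smul, IsEnvelopingAction.ι_smul,
      LieModuleHom.coe_toLinearMap, hf x hx, smul_zero]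

/-- The universal property of the induced module `N(λ)`. -/
def NLift (f : C.F lam →ₗ⁅ℂ,S.kC⁆ M) (hf : ∀ x : Cplx 𝔤, ⁅C.Z₀, x⁆ = x → ∀ v, ⁅x, f v⁆ = 0) :
    C.N lam →ₗ[UniversalEnvelopingAlgebra ℂ (Cplx 𝔤)] M :=
  (C.inducedRel lam).liftQ _ (inducedRel_le_ker_liftTensor hf)

theorem NLift_NVector (f : C.F lam →ₗ⁅ℂ,S.kC⁆ M)
    (hf : ∀ x : Cplx 𝔤, ⁅C.Z₀, x⁆ = x → ∀ v, ⁅x, f v⁆ = 0) :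
    NLift f hf (C.NVector lam) = f (C.FVector lam) :=
  (liftTensor_tmul _ _ _).trans
    (one_smul (UniversalEnvelopingAlgebra ℂ (Cplx 𝔤)) _)

end UniversalProperty

theorem isTopVector_NVector [FiniteDimensional ℝ 𝔤] [LieAlgebra.IsSimple ℝ 𝔤] {X₀ : C.t}
    (hX₀ : ∀ α ∈ roots C.t, α ∉ C.pos → α X₀ < 0) :
    IsTopVector (iMul (X₀ : 𝔤)) (lam X₀) (C.NVector lam) :=
  isTopVector_of_lie_eq (j := LieHom.id) Function.injective_id C.iSup_rootSubmodule_eq_top hX₀ rfl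
    (fun X => ⟨_, rfl, lie_iMul_NVector X⟩) fun _ hα _ hx => lie_NVector_of_mem_rootSpace hα hx

end N

section L

instance (lam : C.Weight) : IsEnvelopingAction ℂ (Cplx 𝔤) (C.L lam) := ⟨fun _ _ => rfl⟩

instance (lam : C.Weight) [Nontrivial (C.L lam)] :
    LieModule.IsIrreducible ℂ (Cplx 𝔤) (C.L lam) :=
  have : Nontrivial (C.N lam ⧸ C.J lam) := ‹Nontrivial (C.L lam)›
  have : IsSimpleModule (UniversalEnvelopingAlgebra ℂ (Cplx 𝔤)) (C.L lam) :=
    isSimpleModule_quotient_sumOfProperSubmodules _ (C.N lam)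
  isIrreducible_of_isSimpleModule ℂ (Cplx 𝔤) (C.L lam)

variable (C) in
/-- The projection from `N(λ)` to its simple quotient `L(λ)`. -/
def NToL (lam : C.Weight) : C.N lam →ₗ[UniversalEnvelopingAlgebra ℂ (Cplx 𝔤)] C.L lam :=
  Submodule.mkQ _

variable (C) in
/-- The canonical highest weight vector of `L(λ)`. -/
def LVector (lam : C.Weight) : C.L lam := C.NToL lam (C.NVector lam)

theorem span_LVector :
    Submodule.span (UniversalEnvelopingAlgebra ℂ (Cplx 𝔤)) {C.LVector lam} = ⊤ := by
  have hπ : Function.Surjective (C.NToL lam) := Submodule.mkQ_surjective _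
  rw [LVector, ← Set.image_singleton, Submodule.span_image, span_NVector, Submodule.map_top,
    LinearMap.range_eq_top.mpr hπ]

variable (C) in
theorem isHighestWeightVector_LVector [FiniteDimensional ℝ 𝔤] [LieAlgebra.IsSimple ℝ 𝔤]
    [Nontrivial (C.L lam)] : C.IsHighestWeightVector lam (C.LVector lam) := by
  have lie_LVector (x : Cplx 𝔤) : ⁅x, C.LVector lam⁆ = C.NToL lam ⁅x, C.NVector lam⁆ :=
    ((lieModuleHomOfEnveloping (R := ℂ) (C.NToL lam)).map_lie x (C.NVector lam)).symm
  refine ⟨fun h => ?_, fun X => ?_, fun α hα x hx => ?_⟩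
  · have hspan := span_LVector (C := C) (lam := lam)
    rw [h, Submodule.span_zero_singleton] at hspan
    exact bot_ne_top hspan
  · rw [lie_LVector, lie_iMul_NVector, LinearMap.map_smul_of_tower, LVector]
  · rw [lie_LVector, lie_NVector_of_mem_rootSpace hα hx, map_zero]

/-- A homomorphism on `N(λ)` which kills all proper submodules, as a homomorphism on `L(λ)`. -/
def LLift {M : Type*} [AddCommGroup M] [Module (UniversalEnvelopingAlgebra ℂ (Cplx 𝔤)) M]
    (f : C.N lam →ₗ[UniversalEnvelopingAlgebra ℂ (Cplx 𝔤)] M)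
    (hf : C.J lam ≤ LinearMap.ker f) : C.L lam →ₗ[UniversalEnvelopingAlgebra ℂ (Cplx 𝔤)] M :=
  Submodule.liftQ _ f hf

variable [FiniteDimensional ℝ 𝔤] [LieAlgebra.IsSimple ℝ 𝔤]
  {M : Type*} [AddCommGroup M] [Module ℂ M] [LieRingModule (Cplx 𝔤) M] [LieModule ℂ (Cplx 𝔤) M]

theorem IsHighestWeightVector.exists_L_hom (hM : IsUnitarizable (𝔤 := 𝔤) M) {m : M}
    (hm : C.IsHighestWeightVector lam m) :
    ∃ f : C.L lam →ₗ⁅ℂ,Cplx 𝔤⁆ M, f (C.LVector lam) = m := by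
  obtain ⟨f, rfl⟩ := hm.exists_F_hom hM
  obtain ⟨B, hB, hBstar⟩ := hM.exists_isPosDefForm
  obtain ⟨X₀, hX₀⟩ := C.exists_regular
  let := envelopingModule ℂ (Cplx 𝔤) M
  have := isEnvelopingAction_envelopingModule ℂ (Cplx 𝔤) M
  have := isScalarTower_envelopingModule ℂ (Cplx 𝔤) M
  have hcontra : IsContravariant B (iMul (X₀ : 𝔤)) :=
    ⟨fun x => ⟨_, hBstar x⟩, fun v w => by rw [hBstar, cplxStar_iMul]⟩
  have hf : ∀ x : Cplx 𝔤, ⁅C.Z₀, x⁆ = x → ∀ v, ⁅x, f v⁆ = 0 := fun _ => lie_eq_zero_of_Z₀_lie_eq hm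
  let g := NLift f hf
  have hker : C.J lam ≤ LinearMap.ker g :=
    sumOfProperSubmodules_le_ker hcontra hB.eq_zero (isTopVector_NVector hX₀) span_NVector g
  exact ⟨lieModuleHomOfEnveloping (LLift g hker), NLift_NVector f hf⟩

theorem IsHighestWeightVector.nonempty_lieEquiv (hM : IsUnitarizable (𝔤 := 𝔤) M) {m : M}
    (hm : C.IsHighestWeightVector lam m) (hspan : LieSubmodule.lieSpan ℂ (Cplx 𝔤) {m} = ⊤) :
    Nonempty (C.L lam ≃ₗ⁅ℂ,Cplx 𝔤⁆ M) := by
  obtain ⟨f, rfl⟩ := hm.exists_L_hom hM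
  have hsurj : Function.Surjective f := by
    rw [← LieModuleHom.range_eq_top, ← top_le_iff, ← hspan, LieSubmodule.lieSpan_le,
      Set.singleton_subset_iff]
    exact (f.mem_range _).mpr ⟨_, rfl⟩
  have : Nontrivial (C.L lam) :=
    nontrivial_of_ne (C.LVector lam) 0 fun h => hm.1 (by rw [h, map_zero])
  let e := LinearEquiv.ofBijective (f : C.L lam →ₗ[ℂ] M) ⟨injective_of_apply_ne_zero f hm.1, hsurj⟩
  exact ⟨{ f with
    invFun := e.symm
    left_inv := e.left_inv
    right_inv := e.right_inv }⟩

theorem IsHighestWeightVector.sphericalFunctional_apply_ne_zero {v : C.L lam}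
    (hv : C.IsHighestWeightVector lam v) (hS : S.IsCompactlyCausal)
    {ν : C.L lam →ₛₗ[starRingEnd ℂ] ℂ} (hν : S.IsSphericalFunctional ν) : ν v ≠ 0 := by
  have : Nontrivial (C.L lam) := nontrivial_of_ne v 0 hv.1
  refine hν.apply_ne_zero (C.hC_sup_eq_top hS (cplxSpan_le_iff.mpr fun X hX => ?_)
    fun α hα x hx => ?_) (lieSpan_singleton_eq_top hv.1)
  · rw [mem_lineStabilizer, hv.2.1 ⟨X, hX⟩]
    exact Submodule.smul_mem _ _ (Submodule.mem_span_singleton_self v)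
  · rw [mem_lineStabilizer, hv.2.2 α hα x (mem_rootSubmodule.mp hx)]
    exact zero_mem _

end L

section Products

variable {mu : C.Weight}

theorem IsDominantIntegral.add (hlam : C.IsDominantIntegral lam)
    (hmu : C.IsDominantIntegral mu) : C.IsDominantIntegral (lam + mu) := fun α hα X hX => by
  obtain ⟨m, hm⟩ := hlam α hα X hX
  obtain ⟨n, hn⟩ := hmu α hα X hX
  exact ⟨m + n, by rw [LinearMap.add_apply, hm, hn, Nat.cast_add]⟩

theorem IsHighestWeightVector.tmul {V W : Type*} [AddCommGroup V] [Module ℂ V]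
    [LieRingModule (Cplx 𝔤) V] [LieModule ℂ (Cplx 𝔤) V] [AddCommGroup W] [Module ℂ W]
    [LieRingModule (Cplx 𝔤) W] [LieModule ℂ (Cplx 𝔤) W] {v : V} {w : W}
    (hv : C.IsHighestWeightVector lam v) (hw : C.IsHighestWeightVector mu w) :
    C.IsHighestWeightVector (lam + mu) (v ⊗ₜ[ℂ] w) := by
  refine ⟨tmul_ne_zero hv.1 hw.1, fun X => ?_, fun α hα x hx => ?_⟩
  · rw [TensorProduct.LieModule.lie_tmul_right, hv.2.1, hw.2.1, LinearMap.add_apply,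
      TensorProduct.tmul_smul, ← TensorProduct.smul_tmul', ← add_smul, Complex.ofReal_add]
  · rw [TensorProduct.LieModule.lie_tmul_right, hv.2.2 α hα x hx, hw.2.2 α hα x hx,
      TensorProduct.zero_tmul, TensorProduct.tmul_zero, add_zero]

/-- The generator `v ⊗ w` of the submodule `tensorSubmodule`, as an element of that submodule. -/
def tensorVector (v : C.L lam) (w : C.L mu) : C.tensorSubmodule lam mu v w :=
  ⟨v ⊗ₜ[ℂ] w, LieSubmodule.subset_lieSpan rfl⟩

theorem lieSpan_tensorVector (v : C.L lam) (w : C.L mu) :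
    LieSubmodule.lieSpan ℂ (Cplx 𝔤) {tensorVector v w} = ⊤ := by
  let P := LieSubmodule.lieSpan ℂ (Cplx 𝔤) {tensorVector v w}
  have h : C.tensorSubmodule lam mu v w ≤ P.map (C.tensorSubmodule lam mu v w).incl :=
    LieSubmodule.lieSpan_le.mpr <| Set.singleton_subset_iff.mpr <|
      (LieSubmodule.mem_map _).mpr ⟨_, LieSubmodule.subset_lieSpan rfl, rfl⟩
  rw [eq_top_iff]
  rintro ⟨x, hx⟩ -
  obtain ⟨y, hy, hyx⟩ := (LieSubmodule.mem_map _).mp (h hx)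
  rwa [← show y = ⟨x, hx⟩ from Subtype.ext hyx]

theorem IsHighestWeightVector.nonempty_lieEquiv_tensorSubmodule [FiniteDimensional ℝ 𝔤]
    [LieAlgebra.IsSimple ℝ 𝔤] {v : C.L lam} {w : C.L mu} (hv : C.IsHighestWeightVector lam v)
    (hw : C.IsHighestWeightVector mu w) (hlam : IsUnitarizable (𝔤 := 𝔤) (C.L lam))
    (hmu : IsUnitarizable (𝔤 := 𝔤) (C.L mu)) :
    Nonempty (C.L (lam + mu) ≃ₗ⁅ℂ,Cplx 𝔤⁆ C.tensorSubmodule lam mu v w) := by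
  have h := hv.tmul hw
  have hvw : C.IsHighestWeightVector (lam + mu) (tensorVector v w) :=
    ⟨fun h0 => h.1 (congrArg Subtype.val h0), fun X => Subtype.ext (h.2.1 X),
      fun α hα x hx => Subtype.ext (h.2.2 α hα x hx)⟩
  exact hvw.nonempty_lieEquiv ((hlam.tensorProduct hmu).of_injective
    (C.tensorSubmodule lam mu v w).incl Subtype.val_injective) (lieSpan_tensorVector v w)

theorem antilinearTensor_lie_eq_zero {V W : Type*} [AddCommGroup V] [Module ℂ V]
    [LieRingModule (Cplx 𝔤) V] [LieModule ℂ (Cplx 𝔤) V] [AddCommGroup W] [Module ℂ W]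
    [LieRingModule (Cplx 𝔤) W] [LieModule ℂ (Cplx 𝔤) W] {ν₁ : V →ₛₗ[starRingEnd ℂ] ℂ}
    {ν₂ : W →ₛₗ[starRingEnd ℂ] ℂ} {x : Cplx 𝔤} (h₁ : ∀ v, ν₁ ⁅x, v⁆ = 0) (h₂ : ∀ w, ν₂ ⁅x, w⁆ = 0)
    (t : V ⊗[ℂ] W) : antilinearTensor ν₁ ν₂ ⁅x, t⁆ = 0 := by
  induction t with
  | zero => rw [lie_zero, map_zero]
  | tmul v w =>
    rw [TensorProduct.LieModule.lie_tmul_right, map_add, antilinearTensor_tmul,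
      antilinearTensor_tmul, h₁, h₂, zero_mul, mul_zero, add_zero]
  | add s t hs ht => rw [lie_add, map_add, hs, ht, add_zero]

theorem IsHighestWeightVector.isSphericalFunctional_antilinearTensor [FiniteDimensional ℝ 𝔤]
    [LieAlgebra.IsSimple ℝ 𝔤] {v : C.L lam} {w : C.L mu} (hv : C.IsHighestWeightVector lam v)
    (hw : C.IsHighestWeightVector mu w) (hS : S.IsCompactlyCausal)
    {ν₁ : C.L lam →ₛₗ[starRingEnd ℂ] ℂ}
    {ν₂ : C.L mu →ₛₗ[starRingEnd ℂ] ℂ} (hν₁ : S.IsSphericalFunctional ν₁)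
    (hν₂ : S.IsSphericalFunctional ν₂) :
    S.IsSphericalFunctional
      ((antilinearTensor ν₁ ν₂).comp (C.tensorSubmodule lam mu v w).toSubmodule.subtype :
        C.tensorSubmodule lam mu v w →ₛₗ[starRingEnd ℂ] ℂ) := by
  refine ⟨fun h => ?_, fun X hX u => antilinearTensor_lie_eq_zero (hν₁.2 X hX) (hν₂.2 X hX) _⟩
  have hvw : antilinearTensor ν₁ ν₂ (v ⊗ₜ[ℂ] w) = 0 := LinearMap.congr_fun h (tensorVector v w)
  rw [antilinearTensor_tmul] at hvw
  exact mul_ne_zero (hv.sphericalFunctional_apply_ne_zero hS hν₁)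
    (hw.sphericalFunctional_apply_ne_zero hS hν₂) hvw

end Products

end HermitianSymmetric.CartanData

section SphericalFunctionals

variable {V W : Type*} [AddCommGroup V] [Module ℂ V] [LieRingModule (Cplx 𝔤) V]
  [AddCommGroup W] [Module ℂ W] [LieRingModule (Cplx 𝔤) W]

theorem HermitianSymmetric.IsSphericalFunctional.comp_lieEquiv {ν : W →ₛₗ[starRingEnd ℂ] ℂ}
    (hν : S.IsSphericalFunctional ν) (e : V ≃ₗ⁅ℂ,Cplx 𝔤⁆ W) :
    S.IsSphericalFunctional (ν.comp (e : V →ₗ[ℂ] W)) := by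
  refine ⟨fun h => hν.1 (LinearMap.ext fun w => ?_), fun X hX v => ?_⟩
  · obtain ⟨v, rfl⟩ := e.surjective w
    exact LinearMap.congr_fun h v
  · exact (congrArg ν (e.toLieModuleHom.map_lie _ v)).trans (hν.2 X hX _)

theorem HermitianSymmetric.IsSpherical.nontrivial (hV : S.IsSpherical V) : Nontrivial V := by
  obtain ⟨ν, hν, -⟩ := hV
  obtain ⟨v, hv⟩ := DFunLike.ne_iff.mp hν
  exact nontrivial_of_ne v 0 fun h => hv (by rw [h, map_zero, map_zero])

end SphericalFunctionals

end HighestWeightModules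

end

theorem lemmaV13 {𝔤 : Type*} [LieRing 𝔤] [LieAlgebra ℝ 𝔤] [FiniteDimensional ℝ 𝔤]
    [LieAlgebra.IsSimple ℝ 𝔤] (S : HermitianSymmetric 𝔤) (hS : S.IsCompactlyCausal)
    (C : S.CartanData) (lam mu : C.Weight)
    (hlam : C.IsDominantIntegral lam) (hmu : C.IsDominantIntegral mu)
    (hlam_unitary : IsUnitarizable (𝔤 := 𝔤) (C.L lam)) (hlam_spherical : S.IsSpherical (C.L lam))
    (hmu_unitary : IsUnitarizable (𝔤 := 𝔤) (C.L mu)) (hmu_spherical : S.IsSpherical (C.L mu)) :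
    C.IsDominantIntegral (lam + mu) ∧
    IsUnitarizable (𝔤 := 𝔤) (C.L (lam + mu)) ∧
    S.IsSpherical (C.L (lam + mu)) ∧
    (∃ v : C.L lam, C.IsHighestWeightVector lam v) ∧
    (∃ w : C.L mu, C.IsHighestWeightVector mu w) ∧
    ∀ (v : C.L lam) (w : C.L mu),
      C.IsHighestWeightVector lam v → C.IsHighestWeightVector mu w →
      Nonempty (C.L (lam + mu) ≃ₗ⁅ℂ, Cplx 𝔤⁆ C.tensorSubmodule lam mu v w) ∧
      ∀ (ν₁ : C.L lam →ₛₗ[starRingEnd ℂ] ℂ) (ν₂ : C.L mu →ₛₗ[starRingEnd ℂ] ℂ),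
        S.IsSphericalFunctional ν₁ → S.IsSphericalFunctional ν₂ →
        S.IsSphericalFunctional
          ((antilinearTensor ν₁ ν₂).comp
            (C.tensorSubmodule lam mu v w).toSubmodule.subtype :
            C.tensorSubmodule lam mu v w →ₛₗ[starRingEnd ℂ] ℂ) := by
  have := hlam_spherical.nontrivial
  have := hmu_spherical.nontrivial
  have hv := C.isHighestWeightVector_LVector (lam := lam)
  have hw := C.isHighestWeightVector_LVector (lam := mu)
  have equiv {v : C.L lam} {w : C.L mu} (hv : C.IsHighestWeightVector lam v)
      (hw : C.IsHighestWeightVector mu w) :=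
    hv.nonempty_lieEquiv_tensorSubmodule hw hlam_unitary hmu_unitary
  obtain ⟨e⟩ := equiv hv hw
  obtain ⟨ν₁, hν₁⟩ := hlam_spherical
  obtain ⟨ν₂, hν₂⟩ := hmu_spherical
  exact ⟨hlam.add hmu,
    (hlam_unitary.tensorProduct hmu_unitary).of_injective
      ((C.tensorSubmodule lam mu _ _).incl.comp e.toLieModuleHom)
      (Subtype.val_injective.comp e.injective),
    ⟨_, (hv.isSphericalFunctional_antilinearTensor hw hS hν₁ hν₂).comp_lieEquiv e⟩,
    ⟨_, hv⟩, ⟨_, hw⟩, fun _ _ hv hw =>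
      ⟨equiv hv hw, fun _ _ => hv.isSphericalFunctional_antilinearTensor hw hS⟩⟩
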